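/- \textbf{Setting.} Let $\mathcal V=\{1,\dots,N\}$ and let $\mathcal E^0\subseteq\mathcal V\times\mathcal V$ be a set of edges without self-loops; $(i,j)$ is the edge from $j$ to $i$. The Laplacian $L(\mathcal E)$ of a graph with edge set $\mathcal E$ has entries $l_{ij}=-1$ if $i\ne j$ and $(i,j)\in\mathcal E$, $l_{ij}=0$ if $i\neq j$ and $(i,j)\notin\mathcal E$, and $l_{ii}=-\sum_{l\ne i}l_{il}$. Put $L^0=L(\mathcal E^0)$. Let $\sigma_k$ be a time-homogeneous Markov chain on a finite set of modes $\mathcal K$ with transition probabilities $t_{ab}$ and initial distribution $\mu$; in mode $a\in\mathcal K$ exactly the edges in $\mathcal E_a\subseteq\mathcal E^0$ transmit, $L_a=L(\mathcal E_a)$, and $\theta^{ij}_k=1$ if $(i,j)\in\mathcal E_{\sigma_k}$, $\theta^{ij}_k=0$ otherwise, for $(i,j)\in\mathcal E^0$. Given $A^d,A^c,A^p\in\mathbb R^{n_x\times n_x}$, the decomposable Markov jump linear system (MJLS) is $x_{k+1}=A_{\sigma_k}x_k$ with $A_a=I_N\otimes A^d+L_a\otimes A^c+L^0\otimes A^p$.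 It is mean-square stable if $\mathbb E\|x_k\|\to0$ and $\mathbb E\|x_kx_k^\top\|\to0$ for every initial state $x_0\in\mathbb R^{Nn_x}$ and all initial conditions $\sigma_0$ of the chain. \textbf{Assumptions.} (1) Under the initial distribution $\mu$ and also when the chain is started from any given mode, $\Pr[\theta^{ij}_{k+1}=1\mid\theta^{ij}_k=1]=p^{ij}$ and $\Pr[\theta^{ij}_{k+1}=1\mid\theta^{ij}_k=0]=q^{ij}$ for all $k\ge0$ and $(i,j)\in\mathcal E^0$ (whenever the condition has positive probability), and the families of processes $\{\theta^{ij}_k,\theta^{ji}_k\}_{k\ge0}$ that belong to distinct unordered pairs $\{i,j\}$ are (mutually) independent; under $\mu$, moreover, $\Pr[\theta^{ij}_0=1]=\eta^{ij}$. (2) $\mathcal E^0$ is undirected, $p^{ij}=p^{ji}$, $q^{ij}=q^{ji}$, $\eta^{ij}=\eta^{ji}$ for $(i,j)\in\mathcal E^0$, and either $\theta^{ij}=\theta^{ji}$ in every mode for all $(i,j)\in\mathcal E^0$, or $p^{ij}=q^{ij}$ for all $(i,j)\in\mathcal E^0$. (3) $p^{ij},q^{ij},\eta^{ij}\in[\rho_l,\rho_u]$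 for all $(i,j)\in\mathcal E^0$, where $0\le\rho_l\le\rho_u\le1$. \textbf{Multipliers.} Let $$\boldsymbol\Delta=\left\{\begin{bmatrix}a&0\\b&0\\0&a\end{bmatrix}: a,b\ge0,\ a^2\in[\rho_l,\rho_u],\ b^2=1-a^2\right\},$$ $$\mathcal P_\alpha=\left\{P=P^\top\in\mathbb R^{5\alpha\times5\alpha}:\begin{bmatrix}\Delta\otimes I_\alpha\\I_{2\alpha}\end{bmatrix}^\top P\begin{bmatrix}\Delta\otimes I_\alpha\\I_{2\alpha}\end{bmatrix}\succ0\ \ \forall\Delta\in\boldsymbol\Delta\right\},$$ where $M\succ0$ ($M\prec 0$) means that $M$ is symmetric positive (negative) definite, and let $\mathcal B_j\in\mathbb R^{n_x\times3n_x}$ be the $j$th block row of $I_3\otimes I_{n_x}$. \textbf{Theorem (Robust Stability Test).} Under these assumptions the MJLS is mean-square stable if there exist $Y\succ0$ in $\mathbb R^{n_x\times n_x}$ and $P\in\mathcal P_{n_x}$ such that $A^{d\top}YA^d-Y\prec0$ and, for every non-zero eigenvalue $\lambda$ of $L^0$, $$W_\lambda^\top\,\operatorname{diag}(-Y,\;Y,\;2Y,\;P)\,W_\lambda\prec0,\qquad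 W_\lambda=\begin{bmatrix}I&0\\A^d+\lambda A^p&\sqrt{\lambda}\,\mathcal B_1\\0&\mathcal B_2\\0&I\\0&\mathcal B_3\\\sqrt{\lambda}A^c&0\end{bmatrix}.$$ The number of distinct non-zero eigenvalues of $L^0$ is at most $N-1$ (at most $0$ if $N=0$), so for $N\ge1$ there are at most $N$ matrix inequalities besides $Y\succ0$ and $P\in\mathcal P_{n_x}$, each of a size that does not depend on $N$. -/

import Mathlib

open MeasureTheory ProbabilityTheory Filter Topology Matrix
open scoped Kronecker

noncomputable section

/-! ### Markov jump linear systems -/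

/-- The (autonomous part of a) Markov jump linear system `x (k+1) = A (σ k) x k` with modes `K`:
the mode-dependent state matrices, the transition probabilities `t i j` of the mode chain `σ`,
and its initial distribution `μ`. -/
structure MJLS (K ι : Type*) [Fintype K] where
  A : K → Matrix ι ι ℝ
  t : K → K → ℝ
  μ : K → ℝ
  t_nonneg : ∀ i j, 0 ≤ t i j
  t_sum : ∀ i, ∑ j, t i j = 1
  μ_nonneg : ∀ i, 0 ≤ μ i
  μ_sum : ∑ i, μ i = 1

/-- `σ` is a Markov chain with transition probabilities `t` and initial distribution `ν`. -/
structure IsMarkovChain {K Ω : Type*} [MeasurableSpace Ω] (t : K → K → ℝ) (ν : K → ℝ)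
    (P : Measure Ω) (σ : ℕ → Ω → K) : Prop where
  measurable : ∀ k i, MeasurableSet {ω | σ k ω = i}
  law : ∀ (n : ℕ) (s : ℕ → K),
    P.real {ω | ∀ k ≤ n, σ k ω = s k} = ν (s 0) * ∏ k ∈ Finset.range n, t (s k) (s (k + 1))

/-- The state trajectory of `x (k+1) = A (s k) x k`, `x 0 = x₀`, along the mode sequence `s`. -/
def stateTrajectory {K ι : Type*} [Fintype ι] (A : K → Matrix ι ι ℝ)
    (x₀ : EuclideanSpace ℝ ι) (s : ℕ → K) : ℕ → EuclideanSpace ℝ ι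
  | 0 => x₀
  | k + 1 => WithLp.toLp 2 (A (s k) *ᵥ (stateTrajectory A x₀ s k).ofLp)

/-- Mean-square stability: `E ‖x k‖ → 0` and `E ‖x k (x k)ᵀ‖ → 0` (spectral norm) for every
initial state and every initial condition of the mode chain (every initial distribution `ν`, in
particular every deterministic initial mode). -/
def MJLS.MeanSquareStable {K ι : Type*} [Fintype K] [Fintype ι] [DecidableEq ι]
    (M : MJLS K ι) : Prop :=
  ∀ (x₀ : EuclideanSpace ℝ ι) (ν : K → ℝ) (Ω : Type) (_ : MeasurableSpace Ω) (P : Measure Ω)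
    (σ : ℕ → Ω → K), IsProbabilityMeasure P → IsMarkovChain M.t ν P σ →
    Tendsto (fun k => ∫ ω, ‖stateTrajectory M.A x₀ (fun l => σ l ω) k‖ ∂P) atTop (𝓝 0) ∧
    Tendsto (fun k => ∫ ω, ‖Matrix.toEuclideanCLM (n := ι) (𝕜 := ℝ)
      (Matrix.vecMulVec (stateTrajectory M.A x₀ (fun l => σ l ω) k).ofLp
        (stateTrajectory M.A x₀ (fun l => σ l ω) k).ofLp)‖ ∂P) atTop (𝓝 0)

/-! ### Graphs and Laplacians

A graph on the agents `Fin N` is its set of directed edges; the pair `(i, j)` is the edge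
from `j` to `i`. -/

/-- The Laplacian of the graph with edge set `E`. -/
def graphLaplacian {N : ℕ} (E : Finset (Fin N × Fin N)) : Matrix (Fin N) (Fin N) ℝ :=
  Matrix.of fun i j =>
    if i = j then -∑ l ∈ Finset.univ.filter (fun l => l ≠ i), (if (i, l) ∈ E then (-1 : ℝ) else 0)
    else if (i, j) ∈ E then -1 else 0

/-! ### Packet loss -/

/-- The family of processes `θ k (i, j) ∈ {0, 1}`, where `θ k e = 1` iff `e ∈ S k ω`, `S k ω`
being the set of edges of the nominal graph `E₀` that transmit at time `k`: each has the transition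
probabilities `P(θ (k+1) = 1 | θ k = 1) = p` and `P(θ (k+1) = 1 | θ k = 0) = q` (wherever
the condition has positive probability), and the processes that belong to distinct unordered
pairs of agents are independent. -/
structure IsLossProcess {N : ℕ} {Ω : Type*} [MeasurableSpace Ω]
    (E₀ : Finset (Fin N × Fin N)) (p q : Fin N → Fin N → ℝ) (P : Measure Ω)
    (S : ℕ → Ω → Finset (Fin N × Fin N)) : Prop where
  success : ∀ (k : ℕ) (i j : Fin N), (i, j) ∈ E₀ → P {ω | (i, j) ∈ S k ω} ≠ 0 →
    (ProbabilityTheory.cond P {ω | (i, j) ∈ S k ω}).real {ω | (i, j) ∈ S (k + 1) ω} = p i j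
  failure : ∀ (k : ℕ) (i j : Fin N), (i, j) ∈ E₀ → P {ω | (i, j) ∉ S k ω} ≠ 0 →
    (ProbabilityTheory.cond P {ω | (i, j) ∉ S k ω}).real {ω | (i, j) ∈ S (k + 1) ω} = q i j
  indep : iIndep (fun z : Sym2 (Fin N) => MeasurableSpace.generateFrom
    {T : Set Ω | ∃ (k : ℕ) (i j : Fin N), (i, j) ∈ E₀ ∧ s(i, j) = z ∧
      T = {ω | (i, j) ∈ S k ω}}) P

/-- Markovian packet loss on the nominal graph `E₀`. The modes `K` of the chain with transition
probabilities `t` and initial distribution `μ` encode which edges transmit: in mode `a` these are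
the edges in `E a`. The processes `θ` read off from the chain have transition probabilities `p`,
`q`, are independent for distinct pairs of agents, and satisfy `P(θ 0 = 1) = η` under `μ`.
The first two hold whether the chain is started from `μ` or from any given mode. -/
structure IsMarkovPacketLoss {N : ℕ} {K : Type*} [Fintype K] [DecidableEq K]
    (E₀ : Finset (Fin N × Fin N)) (E : K → Finset (Fin N × Fin N))
    (t : K → K → ℝ) (μ : K → ℝ) (p q η : Fin N → Fin N → ℝ) : Prop where
  subset : ∀ a, E a ⊆ E₀
  initial : ∀ i j, (i, j) ∈ E₀ →
    ∑ a ∈ Finset.univ.filter (fun a => (i, j) ∈ E a), μ a = η i j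
  process : ∀ ν : K → ℝ, (ν = μ ∨ ∃ a, ν = Pi.single a 1) →
    ∀ (Ω : Type) (_ : MeasurableSpace Ω) (P : Measure Ω) (σ : ℕ → Ω → K),
      IsProbabilityMeasure P → IsMarkovChain t ν P σ →
      IsLossProcess E₀ p q P (fun k ω => E (σ k ω))

/-- The nominal graph is undirected, the transition probabilities are symmetric, and the packet
loss is either symmetric (in every mode) or independent in time. -/
structure IsSymmetricLoss {N : ℕ} {K : Type*}
    (E₀ : Finset (Fin N × Fin N)) (E : K → Finset (Fin N × Fin N))
    (p q η : Fin N → Fin N → ℝ) : Prop where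
  undirected : ∀ i j, (i, j) ∈ E₀ ↔ (j, i) ∈ E₀
  p_symm : ∀ i j, (i, j) ∈ E₀ → p i j = p j i
  q_symm : ∀ i j, (i, j) ∈ E₀ → q i j = q j i
  η_symm : ∀ i j, (i, j) ∈ E₀ → η i j = η j i
  symmetric_or_independent : (∀ a i j, (i, j) ∈ E₀ → ((i, j) ∈ E a ↔ (j, i) ∈ E a)) ∨
    (∀ i j, (i, j) ∈ E₀ → p i j = q i j)

/-- Uniform bounds on all the transition and initial probabilities. -/
structure IsBoundedLoss {N : ℕ} (E₀ : Finset (Fin N × Fin N)) (p q η : Fin N → Fin N → ℝ)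
    (ρl ρu : ℝ) : Prop where
  nonneg : 0 ≤ ρl
  le : ρl ≤ ρu
  le_one : ρu ≤ 1
  p_mem : ∀ i j, (i, j) ∈ E₀ → p i j ∈ Set.Icc ρl ρu
  q_mem : ∀ i j, (i, j) ∈ E₀ → q i j ∈ Set.Icc ρl ρu
  η_mem : ∀ i j, (i, j) ∈ E₀ → η i j ∈ Set.Icc ρl ρu

/-! ### The linear matrix inequalities -/

/-- The uncertainty set of a single link. -/
def uncertaintySet (ρl ρu : ℝ) : Set (Matrix (Fin 3) (Fin 2) ℝ) :=
  {Δ | ∃ a b : ℝ, 0 ≤ a ∧ 0 ≤ b ∧ a ^ 2 ∈ Set.Icc ρl ρu ∧ b ^ 2 = 1 - a ^ 2 ∧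
    Δ = !![a, 0; b, 0; 0, a]}

/-- The outer factor `[Δ ⊗ I; I]` of the multiplier condition. -/
def multiplierOuter (α : ℕ) (Δ : Matrix (Fin 3) (Fin 2) ℝ) :
    Matrix ((Fin 3 × Fin α) ⊕ (Fin 2 × Fin α)) (Fin 2 × Fin α) ℝ :=
  Matrix.fromRows (Δ ⊗ₖ (1 : Matrix (Fin α) (Fin α) ℝ)) 1

/-- The set of symmetric multipliers `P` with `[Δ ⊗ I; I]ᵀ P [Δ ⊗ I; I] ≻ 0` for all `Δ` in the
uncertainty set. -/
def multiplierSet (ρl ρu : ℝ) (α : ℕ) :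
    Set (Matrix ((Fin 3 × Fin α) ⊕ (Fin 2 × Fin α)) ((Fin 3 × Fin α) ⊕ (Fin 2 × Fin α)) ℝ) :=
  {P | P.IsSymm ∧ ∀ Δ ∈ uncertaintySet ρl ρu,
    ((multiplierOuter α Δ)ᵀ * P * multiplierOuter α Δ).PosDef}

/-- The `j`th block row of `I₃ ⊗ Iₙ` (with `j` counted from `0`). -/
def blockRow (n : ℕ) (j : Fin 3) : Matrix (Fin n) (Fin 3 × Fin n) ℝ :=
  Matrix.of fun r c =>
    ((1 : Matrix (Fin 3) (Fin 3) ℝ) ⊗ₖ (1 : Matrix (Fin n) (Fin n) ℝ)) (j, r) c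

/-- Two blocks of `n` rows stacked on top of each other. -/
def stackTwo {n : ℕ} {κ : Type*} (R₀ R₁ : Matrix (Fin n) κ ℝ) : Matrix (Fin 2 × Fin n) κ ℝ :=
  Matrix.of fun r c => (![R₀, R₁] r.1) r.2 c

/-- The outer factor of the modal matrix inequality. -/
def modalOuter {n : ℕ} (Ad Ac Ap : Matrix (Fin n) (Fin n) ℝ) (lam : ℝ) :
    Matrix ((Fin n ⊕ Fin n ⊕ Fin n) ⊕ ((Fin 3 × Fin n) ⊕ (Fin 2 × Fin n)))
      (Fin n ⊕ (Fin 3 × Fin n)) ℝ :=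
  Matrix.fromRows
    (Matrix.fromRows (Matrix.fromCols 1 0)
      (Matrix.fromRows
        (Matrix.fromCols (Ad + lam • Ap) (Real.sqrt lam • blockRow n 0))
        (Matrix.fromCols 0 (blockRow n 1))))
    (Matrix.fromRows (Matrix.fromCols 0 1)
      (stackTwo (Matrix.fromCols 0 (blockRow n 2)) (Matrix.fromCols (Real.sqrt lam • Ac) 0)))

/-- The middle factor `diag(-Y, Y, 2Y, P)` of the modal matrix inequality. -/
def modalMiddle {n : ℕ} (Y : Matrix (Fin n) (Fin n) ℝ)
    (P : Matrix ((Fin 3 × Fin n) ⊕ (Fin 2 × Fin n)) ((Fin 3 × Fin n) ⊕ (Fin 2 × Fin n)) ℝ) :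
    Matrix ((Fin n ⊕ Fin n ⊕ Fin n) ⊕ ((Fin 3 × Fin n) ⊕ (Fin 2 × Fin n)))
      ((Fin n ⊕ Fin n ⊕ Fin n) ⊕ ((Fin 3 × Fin n) ⊕ (Fin 2 × Fin n))) ℝ :=
  Matrix.fromBlocks
    (Matrix.fromBlocks (-Y) 0 0 (Matrix.fromBlocks Y 0 0 ((2 : ℝ) • Y))) 0 0 P

/-- The modal matrix inequality at the eigenvalue `lam`. -/
def ModalLMI {n : ℕ} (Ad Ac Ap Y : Matrix (Fin n) (Fin n) ℝ)
    (P : Matrix ((Fin 3 × Fin n) ⊕ (Fin 2 × Fin n)) ((Fin 3 × Fin n) ⊕ (Fin 2 × Fin n)) ℝ)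
    (lam : ℝ) : Prop :=
  (-((modalOuter Ad Ac Ap lam)ᵀ * modalMiddle Y P * modalOuter Ad Ac Ap lam)).PosDef

/-- The set of non-zero eigenvalues of a real square matrix. -/
def nonzeroEigenvalues {N : ℕ} (L : Matrix (Fin N) (Fin N) ℝ) : Set ℝ :=
  {lam | lam ≠ 0 ∧ Module.End.HasEigenvalue (Matrix.toLin' L) lam}

end

/-!
The Lyapunov function is `V x = xᵀ (I ⊗ Y) x`. Given that the previous mode of the chain is `b`, the
state is fixed and every link succeeds with probability `π = p` or `π = q`, depending on whether it
transmitted in `b`; links at the same receiver are uncorrelated. Hence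
(`mean_bilin_bernoulli_sum`) the conditional mean of `V` at the next step is `V` of the averaged
successor, whose Laplacian is weighted by `π`, plus a variance term that is a Laplacian form weighted
by `π (1 - π)`. It remains to show that this is less than `V x` for `x ≠ 0`
(`mode_average_lyapunov_lt`); compactness of the sphere and finiteness of the set of modes turn this
into a contraction factor below one, and the second moments decay geometrically
(`MJLS.meanSquareStable_of_lyapunov`). The conditional probabilities are obtained from the assumption
on chains started from a given mode: conditioned on a finite part of its path, the chain is again
such a chain after a time shift (`IsMarkovChain.cond_shift`).

The strict decrease (`modal_decrease`) is where the matrix inequalities enter. With the incidence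
matrix `G`, for which `G Gᵀ` is the nominal Laplacian, the average dynamics are a feedback
interconnection in which each link `e` carries the signal `zₑ = Ac (Gᵀ x)ₑ` and returns
`(π zₑ, √(π (1 - π)) zₑ, √π zₑ)`; these are the values of the admissible `Δ` with `a = √π`, so the
multiplier form is non-negative on every link. Quadratic forms of link signals are invariant under
orthogonal transformations across the links, so all signals may be expanded along the
singular vectors of `G`: in the mode of the eigenvalue `λ` the sum of all forms is the modal matrix
inequality at `λ`, for `λ = 0` it is the inequality for `Ad`, and the component of the link signals
orthogonal to the range of `Gᵀ` is covered by any modal inequality with vanishing state.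
-/

/-! ### Quadratic forms of vector-valued signals -/

/-- Pythagoras for a signal with values in a module that carries a symmetric, possibly indefinite,
bilinear form: the signal splits into its coefficients along an orthonormal family `v` (members
of which may be zero) and a residual. -/
theorem sum_bilin_eq_sum_coeff_add_sum_residual {ι κ W : Type*} [Fintype ι] [Fintype κ]
    [AddCommGroup W] [Module ℝ W] (B : LinearMap.BilinForm ℝ W)
    (hB : ∀ x y, B x y = B y x) (v : κ → ι → ℝ)
    (hv : ∀ k l, k ≠ l → ∑ e, v k e * v l e = 0)
    (hv1 : ∀ k, ∑ e, v k e * v k e = 1 ∨ v k = 0) (s : ι → W) :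
    ∑ e, B (s e) (s e) = ∑ k, B (∑ e, v k e • s e) (∑ e, v k e • s e)
      + ∑ e, B (s e - ∑ k, v k e • ∑ e', v k e' • s e')
        (s e - ∑ k, v k e • ∑ e', v k e' • s e') := by
  classical
  set c : κ → W := fun k => ∑ e, v k e • s e with hc
  set q : ι → W := fun e => ∑ k, v k e • c k with hq
  have key : ∀ f : ι → W, ∑ e, B (f e) (q e) = ∑ k, B (∑ e, v k e • f e) (c k) := by
    intro f
    simp only [hq, map_sum, map_smul, LinearMap.sum_apply, LinearMap.smul_apply]
    rw [Finset.sum_comm]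
  -- the part spanned by `v` has the same coefficients as the signal
  have hqc : ∀ k, ∑ e, v k e • q e = c k := by
    intro k
    have : ∑ e, v k e • q e = ∑ l, (∑ e, v k e * v l e) • c l := by
      simp only [hq, Finset.smul_sum, smul_smul, Finset.sum_smul]
      rw [Finset.sum_comm]
    rw [this, Finset.sum_eq_single k]
    · rcases hv1 k with h | h
      · rw [h, one_smul]
      · simp [hc, h]
    · intro l _ hl
      rw [hv k l (Ne.symm hl), zero_smul]
    · simp
  have h1 := key s
  have h2 := key q
  simp only [hqc] at h2
  have h3 : ∀ e, B (s e - q e) (s e - q e) = B (s e) (s e) - 2 * B (s e) (q e) + B (q e) (q e) := by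
    intro e
    simp only [map_sub, LinearMap.sub_apply]
    rw [hB (q e) (s e)]
    ring
  change _ = ∑ k, B (c k) (c k) + ∑ e, B (s e - q e) (s e - q e)
  simp only [h3, Finset.sum_add_distrib, Finset.sum_sub_distrib, ← Finset.mul_sum, h1, h2]
  change _ = ∑ k, B (c k) (c k) + (_ - 2 * ∑ k, B (c k) (c k) + ∑ k, B (c k) (c k))
  ring

theorem toBilin'_comm {ι : Type*} [Fintype ι] [DecidableEq ι] {M : Matrix ι ι ℝ} (hM : M.IsSymm)
    (x y : ι → ℝ) : Matrix.toBilin' M x y = Matrix.toBilin' M y x := by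
  rw [Matrix.toBilin'_apply', Matrix.toBilin'_apply', Matrix.dotProduct_mulVec,
    ← Matrix.mulVec_transpose, hM.eq, dotProduct_comm]

theorem toBilin'_self_nonneg {ι : Type*} [Fintype ι] [DecidableEq ι] {M : Matrix ι ι ℝ}
    (hM : M.PosDef) (x : ι → ℝ) : 0 ≤ Matrix.toBilin' M x x := by
  rw [Matrix.toBilin'_apply']
  simpa using hM.posSemidef.dotProduct_mulVec_nonneg x

/-- The spectral theorem for `G * Gᵀ`, in coordinates. -/
theorem exists_orthonormal_eigenbasis_mul_transpose {ν ι : Type*} [Fintype ν] [DecidableEq ν]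
    [Fintype ι] (G : Matrix ν ι ℝ) :
    ∃ (u : ν → ν → ℝ) (d : ν → ℝ), (∀ k l, ∑ i, u k i * u l i = if k = l then 1 else 0) ∧
      (∀ i j, ∑ k, u k i * u k j = if i = j then 1 else 0) ∧ (∀ k, 0 ≤ d k) ∧
      ∀ k, (G * Gᵀ) *ᵥ u k = d k • u k := by
  have hps : (G * Gᵀ).PosSemidef := by
    simpa using Matrix.posSemidef_self_mul_conjTranspose G
  have hH := hps.isHermitian
  let U : Matrix ν ν ℝ := hH.eigenvectorUnitary
  have hU1 : Uᵀ * U = 1 := by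
    simpa [Matrix.star_eq_conjTranspose] using Unitary.coe_star_mul_self hH.eigenvectorUnitary
  have hU2 : U * Uᵀ = 1 := by
    simpa [Matrix.star_eq_conjTranspose] using Unitary.coe_mul_star_self hH.eigenvectorUnitary
  refine ⟨fun k i => U i k, hH.eigenvalues, ?_, ?_, hps.eigenvalues_nonneg, ?_⟩
  · intro k l
    have := congrFun (congrFun hU1 k) l
    simpa [Matrix.mul_apply, Matrix.one_apply] using this
  · intro i j
    have := congrFun (congrFun hU2 i) j
    simpa [Matrix.mul_apply, Matrix.one_apply] using this
  · intro k
    exact hH.mulVec_eigenvectorBasis k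

/-! ### The matrix inequalities as inequalities between quadratic forms -/

/-- The vector `(w, w₃, z)` on which the multiplier acts in the modal matrix inequality. -/
def multiplierVec {n : ℕ} (w : Fin 3 × Fin n → ℝ) (z : Fin n → ℝ) :
    (Fin 3 × Fin n) ⊕ (Fin 2 × Fin n) → ℝ :=
  Sum.elim w fun c => (![fun r => w (2, r), z] c.1) c.2

theorem modalOuter_mulVec {n : ℕ} (Ad Ac Ap : Matrix (Fin n) (Fin n) ℝ) (lam : ℝ)
    (x : Fin n → ℝ) (w : Fin 3 × Fin n → ℝ) :
    modalOuter Ad Ac Ap lam *ᵥ Sum.elim x w =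
      Sum.elim (Sum.elim x (Sum.elim
        (Ad *ᵥ x + lam • Ap *ᵥ x + Real.sqrt lam • fun r => w (0, r)) fun r => w (1, r)))
        (multiplierVec w (Real.sqrt lam • Ac *ᵥ x)) := by
  have hrow : ∀ j : Fin 3, blockRow n j *ᵥ w = fun r => w (j, r) := by
    intro j
    ext r
    simp [blockRow, Matrix.mulVec, dotProduct, Matrix.kroneckerMap_apply, Matrix.one_apply,
      Fintype.sum_prod_type]
  have hstack : stackTwo (Matrix.fromCols 0 (blockRow n 2))
      (Matrix.fromCols (Real.sqrt lam • Ac) 0) *ᵥ Sum.elim x w =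
        fun c => (![fun r => w (2, r), Real.sqrt lam • Ac *ᵥ x] c.1) c.2 := by
    have h0 : Matrix.fromCols (0 : Matrix (Fin n) (Fin n) ℝ) (blockRow n 2) *ᵥ Sum.elim x w =
        fun r => w (2, r) := by
      rw [Matrix.fromCols_mulVec]; simp [hrow]
    have h1 : Matrix.fromCols (Real.sqrt lam • Ac) (0 : Matrix (Fin n) (Fin 3 × Fin n) ℝ) *ᵥ
        Sum.elim x w = Real.sqrt lam • Ac *ᵥ x := by
      rw [Matrix.fromCols_mulVec]; simp [Matrix.smul_mulVec]
    ext ⟨c, r⟩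
    fin_cases c
    · exact congrFun h0 r
    · exact congrFun h1 r
  rw [modalOuter, Matrix.fromRows_mulVec, Matrix.fromRows_mulVec, Matrix.fromRows_mulVec,
    Matrix.fromRows_mulVec, hstack]
  simp [Matrix.fromCols_mulVec, Matrix.add_mulVec, Matrix.smul_mulVec, hrow, multiplierVec]

/-- The modal matrix inequality evaluated at the state `x` and the link output `w`. -/
theorem modalLMI_neg {n : ℕ} {Ad Ac Ap Y : Matrix (Fin n) (Fin n) ℝ}
    {P : Matrix ((Fin 3 × Fin n) ⊕ (Fin 2 × Fin n)) ((Fin 3 × Fin n) ⊕ (Fin 2 × Fin n)) ℝ}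
    {lam : ℝ} (h : ModalLMI Ad Ac Ap Y P lam) (x : Fin n → ℝ) (w : Fin 3 × Fin n → ℝ)
    (hxw : x ≠ 0 ∨ w ≠ 0) :
    -(toBilin' Y x x)
      + toBilin' Y (Ad *ᵥ x + lam • Ap *ᵥ x + Real.sqrt lam • fun r => w (0, r))
        (Ad *ᵥ x + lam • Ap *ᵥ x + Real.sqrt lam • fun r => w (0, r))
      + (2 * toBilin' Y (fun r => w (1, r)) (fun r => w (1, r))
      + toBilin' P (multiplierVec w (Real.sqrt lam • Ac *ᵥ x))
        (multiplierVec w (Real.sqrt lam • Ac *ᵥ x))) < 0 := by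
  have hne : Sum.elim x w ≠ 0 := by
    intro h0
    rcases hxw with hx | hw
    · exact hx (funext fun i => congrFun h0 (Sum.inl i))
    · exact hw (funext fun i => congrFun h0 (Sum.inr i))
  have := h.dotProduct_mulVec_pos hne
  rw [Matrix.neg_mulVec, dotProduct_neg, star_trivial, ← Matrix.mulVec_mulVec,
    ← Matrix.mulVec_mulVec, Matrix.dotProduct_mulVec, Matrix.vecMul_transpose,
    modalOuter_mulVec, modalMiddle, Matrix.fromBlocks_mulVec] at this
  simp only [Sum.elim_comp_inl, Sum.elim_comp_inr, Matrix.fromBlocks_mulVec, Matrix.zero_mulVec,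
    add_zero, zero_add, Matrix.neg_mulVec, Matrix.smul_mulVec,
    sumElim_dotProduct_sumElim, dotProduct_neg, dotProduct_smul, smul_eq_mul] at this
  simp only [Matrix.toBilin'_apply']
  linarith

/-- The multiplier form is non-negative on the graph of the admissible `Δ`: with input `(a z, z)`
the output is `(a² z, a b z, a z)`. -/
theorem multiplierSet_nonneg {n : ℕ} {ρl ρu : ℝ}
    {P : Matrix ((Fin 3 × Fin n) ⊕ (Fin 2 × Fin n)) ((Fin 3 × Fin n) ⊕ (Fin 2 × Fin n)) ℝ}
    (hP : P ∈ multiplierSet ρl ρu n) {a b : ℝ}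
    (h : !![a, 0; b, 0; 0, a] ∈ uncertaintySet ρl ρu) (z : Fin n → ℝ) :
    0 ≤ toBilin' P (multiplierVec (fun c => (![a * a, a * b, a] c.1) * z c.2) z)
      (multiplierVec (fun c => (![a * a, a * b, a] c.1) * z c.2) z) := by
  have hvec : multiplierOuter n !![a, 0; b, 0; 0, a] *ᵥ
      (fun c => (![a • z, z] c.1) c.2) =
      multiplierVec (fun c => (![a * a, a * b, a] c.1) * z c.2) z := by
    rw [multiplierOuter, Matrix.fromRows_mulVec, multiplierVec, Matrix.one_mulVec]
    congr 1
    · ext ⟨c, r⟩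
      fin_cases c <;>
        simp [Matrix.mulVec, dotProduct, Matrix.kroneckerMap_apply, Matrix.one_apply,
          Fintype.sum_prod_type] <;> ring
  have := (hP.2 _ h).posSemidef.dotProduct_mulVec_nonneg (fun c => (![a • z, z] c.1) c.2)
  rwa [star_trivial, ← Matrix.mulVec_mulVec,
    ← Matrix.mulVec_mulVec, Matrix.dotProduct_mulVec, Matrix.vecMul_transpose, hvec,
    ← Matrix.toBilin'_apply'] at this

/-- The form `2 w₂ᵀ Y w₂ + ζᵀ P ζ` of a single link, where `w₂` is the second block of `ζ`. -/
def linkForm {n : ℕ} (Y : Matrix (Fin n) (Fin n) ℝ)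
    (P : Matrix ((Fin 3 × Fin n) ⊕ (Fin 2 × Fin n)) ((Fin 3 × Fin n) ⊕ (Fin 2 × Fin n)) ℝ) :
    LinearMap.BilinForm ℝ ((Fin 3 × Fin n) ⊕ (Fin 2 × Fin n) → ℝ) :=
  (2 : ℝ) • (toBilin' Y).compl₁₂ (LinearMap.funLeft ℝ ℝ fun r => Sum.inl (1, r))
    (LinearMap.funLeft ℝ ℝ fun r => Sum.inl (1, r)) + toBilin' P

theorem linkForm_multiplierVec {n : ℕ} (Y : Matrix (Fin n) (Fin n) ℝ)
    (P : Matrix ((Fin 3 × Fin n) ⊕ (Fin 2 × Fin n)) ((Fin 3 × Fin n) ⊕ (Fin 2 × Fin n)) ℝ)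
    (w : Fin 3 × Fin n → ℝ) (z : Fin n → ℝ) :
    linkForm Y P (multiplierVec w z) (multiplierVec w z) =
      2 * toBilin' Y (fun r => w (1, r)) (fun r => w (1, r))
        + toBilin' P (multiplierVec w z) (multiplierVec w z) := rfl

theorem linkForm_comm {n : ℕ} {Y : Matrix (Fin n) (Fin n) ℝ}
    {P : Matrix ((Fin 3 × Fin n) ⊕ (Fin 2 × Fin n)) ((Fin 3 × Fin n) ⊕ (Fin 2 × Fin n)) ℝ}
    (hY : Y.IsSymm) (hP : P.IsSymm) (x y) : linkForm Y P x y = linkForm Y P y x := by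
  simp only [linkForm, LinearMap.add_apply, LinearMap.smul_apply, LinearMap.compl₁₂_apply]
  rw [toBilin'_comm hY, toBilin'_comm hP]

theorem sum_smul_multiplierVec {n : ℕ} {ι : Type*} [Fintype ι] (c : ι → ℝ)
    (w : ι → Fin 3 × Fin n → ℝ) (z : ι → Fin n → ℝ) :
    ∑ e, c e • multiplierVec (w e) (z e) =
      multiplierVec (∑ e, c e • w e) (∑ e, c e • z e) := by
  ext t
  rcases t with t | ⟨t, r⟩
  · simp [multiplierVec, Finset.sum_apply]
  · fin_cases t <;> simp [multiplierVec, Finset.sum_apply]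

theorem multiplierVec_sub {n : ℕ} (w w' : Fin 3 × Fin n → ℝ) (z z' : Fin n → ℝ) :
    multiplierVec w z - multiplierVec w' z' = multiplierVec (w - w') (z - z') := by
  ext t
  rcases t with t | ⟨t, r⟩
  · simp [multiplierVec]
  · fin_cases t <;> simp [multiplierVec]

theorem multiplierVec_zero {n : ℕ} :
    multiplierVec (0 : Fin 3 × Fin n → ℝ) (0 : Fin n → ℝ) = 0 := by
  have := multiplierVec_sub (0 : Fin 3 × Fin n → ℝ) 0 0 0
  simpa using this.symm

/-! ### Modal decomposition -/

/-- The modal matrix inequality makes the form of a link non-positive along signals that are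
not driven by the state (which has no component along the corresponding direction). -/
theorem linkForm_nonpos_of_modalLMI {n : ℕ} {Ad Ac Ap Y : Matrix (Fin n) (Fin n) ℝ}
    {P : Matrix ((Fin 3 × Fin n) ⊕ (Fin 2 × Fin n)) ((Fin 3 × Fin n) ⊕ (Fin 2 × Fin n)) ℝ}
    {lam : ℝ} (hY : Y.PosDef) (h : ModalLMI Ad Ac Ap Y P lam) (w : Fin 3 × Fin n → ℝ) :
    linkForm Y P (multiplierVec w 0) (multiplierVec w 0) ≤ 0 := by
  by_cases hw : w = 0
  · subst hw
    simp [multiplierVec_zero]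
  · have := modalLMI_neg h 0 w (Or.inr hw)
    simp only [Matrix.mulVec_zero, smul_zero, map_zero, neg_zero,
      zero_add] at this
    rw [linkForm_multiplierVec]
    linarith [toBilin'_self_nonneg hY (Real.sqrt lam • fun r => w (0, r))]

/-- The sum of the modal inequalities over all singular directions of `G`. Here `z` collects the
link inputs, `a e * a e` is the success probability of the link `e`, `a e * b e` its standard
deviation, and `y` is the averaged successor of the state `x`. -/
theorem modal_decrease {N n : ℕ} {ι : Type*} [Fintype ι] (G : Matrix (Fin N) ι ℝ)
    {Ad Ac Ap Y : Matrix (Fin n) (Fin n) ℝ} {ρl ρu : ℝ}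
    {P : Matrix ((Fin 3 × Fin n) ⊕ (Fin 2 × Fin n)) ((Fin 3 × Fin n) ⊕ (Fin 2 × Fin n)) ℝ}
    (hY : Y.PosDef) (hP : P ∈ multiplierSet ρl ρu n) (hd : (-(Adᵀ * Y * Ad - Y)).PosDef)
    (hLMI : ∀ lam ∈ nonzeroEigenvalues (G * Gᵀ), ModalLMI Ad Ac Ap Y P lam)
    (a b : ι → ℝ) (hab : ∀ e, !![a e, 0; b e, 0; 0, a e] ∈ uncertaintySet ρl ρu)
    (x : Fin N → Fin n → ℝ) (hx : x ≠ 0) (z : ι → Fin n → ℝ)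
    (hz : ∀ e, z e = Ac *ᵥ ∑ i, G i e • x i) (y : Fin N → Fin n → ℝ)
    (hy : ∀ i, y i = Ad *ᵥ x i + ∑ j, (G * Gᵀ) i j • Ap *ᵥ x j
      + ∑ e, G i e • (a e * a e) • z e) :
    ∑ i, toBilin' Y (y i) (y i) + 2 * ∑ e, toBilin' Y ((a e * b e) • z e) ((a e * b e) • z e)
      < ∑ i, toBilin' Y (x i) (x i) := by
  have hYs : Y.IsSymm := by simpa using hY.isHermitian
  obtain ⟨u, d, hu1, hu2, hd0, hud⟩ := exists_orthonormal_eigenbasis_mul_transpose G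
  have hGu : ∀ k l, ∑ e, (∑ i, G i e * u k i) * (∑ i, G i e * u l i) =
      if k = l then d k else 0 := by
    intro k l
    have h1 : (Gᵀ *ᵥ u k) ⬝ᵥ (Gᵀ *ᵥ u l) = u l ⬝ᵥ ((G * Gᵀ) *ᵥ u k) := by
      rw [← Matrix.mulVec_mulVec, Matrix.dotProduct_mulVec (u l), ← Matrix.mulVec_transpose G,
        dotProduct_comm]
    rw [hud, dotProduct_smul, smul_eq_mul] at h1
    change (Gᵀ *ᵥ u k) ⬝ᵥ (Gᵀ *ᵥ u l) = _
    rw [h1]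
    have := hu1 l k
    change u l ⬝ᵥ u k = _ at this
    rw [this]
    simp [eq_comm]
  -- right singular vectors; the inverse of `√0` makes those of zero singular values vanish
  set v : Fin N → ι → ℝ := fun k e => (Real.sqrt (d k))⁻¹ * ∑ i, G i e * u k i with hv
  have hGv : ∀ k e, ∑ i, G i e * u k i = Real.sqrt (d k) * v k e := by
    intro k e
    by_cases hk : d k = 0
    · have h0 := hGu k k
      rw [if_pos rfl, hk, Finset.sum_eq_zero_iff_of_nonneg (fun e _ => mul_self_nonneg _)] at h0
      rw [hk, Real.sqrt_zero, zero_mul]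
      exact mul_self_eq_zero.1 (h0 e (Finset.mem_univ e))
    · have : Real.sqrt (d k) ≠ 0 :=
        Real.sqrt_ne_zero'.2 (lt_of_le_of_ne (hd0 k) (Ne.symm hk))
      simp only [hv]
      field_simp
  have hvv : ∀ k l, ∑ e, v k e * v l e =
      (Real.sqrt (d k))⁻¹ * (Real.sqrt (d l))⁻¹ * if k = l then d k else 0 := by
    intro k l
    rw [← hGu k l, Finset.mul_sum]
    refine Finset.sum_congr rfl fun e _ => ?_
    simp only [hv]; ring
  have hv0 : ∀ k, d k = 0 → v k = 0 := by
    intro k hk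
    ext e
    simp [hv, hk]
  have hvo : ∀ k l, k ≠ l → ∑ e, v k e * v l e = 0 := by
    intro k l hkl
    rw [hvv, if_neg hkl, mul_zero]
  have hvn : ∀ k, ∑ e, v k e * v k e = 1 ∨ v k = 0 := by
    intro k
    by_cases hk : d k = 0
    · exact Or.inr (hv0 k hk)
    · left
      rw [hvv, if_pos rfl]
      have h1 := Real.mul_self_sqrt (hd0 k)
      have : Real.sqrt (d k) ≠ 0 :=
        Real.sqrt_ne_zero'.2 (lt_of_le_of_ne (hd0 k) (Ne.symm hk))
      nth_rewrite 3 [← h1]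
      field_simp
  have hmem : ∀ k, d k ≠ 0 → ModalLMI Ad Ac Ap Y P (d k) := by
    intro k hk
    refine hLMI _ ⟨hk, Module.End.hasEigenvalue_of_hasEigenvector (x := u k) ⟨?_, ?_⟩⟩
    · rw [Module.End.mem_eigenspace_iff, Matrix.toLin'_apply, hud]
    · intro h0
      have := hu1 k k
      simp [h0] at this
  -- modal coordinates
  set X : Fin N → Fin n → ℝ := fun k => ∑ i, u k i • x i with hX
  have hxX : ∀ i, x i = ∑ k, u k i • X k := by
    intro i
    simp only [hX, Finset.smul_sum, smul_smul]
    rw [Finset.sum_comm]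
    simp only [← Finset.sum_smul, hu2, ite_smul, one_smul, zero_smul]
    simp
  have hGx : ∀ e, ∑ i, G i e • x i = ∑ k, v k e • Real.sqrt (d k) • X k := by
    intro e
    have h1 : ∑ i, G i e • x i = ∑ k, (∑ i, G i e * u k i) • X k := by
      conv_lhs => rw [Finset.sum_congr rfl fun i _ => by rw [hxX i]]
      simp only [Finset.smul_sum, smul_smul, Finset.sum_smul]
      rw [Finset.sum_comm]
    rw [h1]
    refine Finset.sum_congr rfl fun k _ => ?_
    rw [hGv, smul_smul, mul_comm]
  have hcoef : ∀ k, ∑ e, v k e • z e = Real.sqrt (d k) • Ac *ᵥ X k := by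
    intro k
    have h1 : ∑ e, v k e • z e =
        ∑ l, ((∑ e, v k e * v l e) * Real.sqrt (d l)) • Ac *ᵥ X l := by
      simp only [hz, hGx, Matrix.mulVec_sum, Matrix.mulVec_smul, Finset.smul_sum, smul_smul,
        Finset.sum_mul, Finset.sum_smul]
      rw [Finset.sum_comm]
      refine Finset.sum_congr rfl fun l _ => Finset.sum_congr rfl fun e _ => ?_
      congr 1
      ring
    rw [h1, Finset.sum_eq_single k]
    · rcases hvn k with h | h
      · rw [h, one_mul]
      · by_cases hk : d k = 0
        · simp [hk]
        · exfalso
          have h2 := hvv k k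
          rw [if_pos rfl, h] at h2
          have : Real.sqrt (d k) ≠ 0 :=
            Real.sqrt_ne_zero'.2 (lt_of_le_of_ne (hd0 k) (Ne.symm hk))
          simp [this, hk] at h2
    · intro l _ hl
      rw [hvo k l (Ne.symm hl), zero_mul, zero_smul]
    · simp
  have hres : ∀ e, z e - ∑ k, v k e • ∑ e', v k e' • z e' = 0 := by
    intro e
    simp only [hcoef]
    rw [hz, hGx, Matrix.mulVec_sum, sub_eq_zero]
    simp only [Matrix.mulVec_smul]
  set w : ι → Fin 3 × Fin n → ℝ :=
    fun e c => (![a e * a e, a e * b e, a e] c.1) * z e c.2 with hw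
  set Wk : Fin N → Fin 3 × Fin n → ℝ := fun k => ∑ e, v k e • w e with hWk
  have hWk0 : ∀ k, d k = 0 → Wk k = 0 := by
    intro k hk
    simp [hWk, hv0 k hk]
  have hw1 : ∀ e, (fun r => w e (1, r)) = (a e * b e) • z e := by
    intro e; ext r; simp [hw]
  -- modal coordinates of the averaged successor state
  have hYk : ∀ k, ∑ i, u k i • y i =
      Ad *ᵥ X k + d k • Ap *ᵥ X k + Real.sqrt (d k) • fun r => Wk k (0, r) := by
    intro k
    simp only [hy, smul_add, Finset.sum_add_distrib]
    congr 1
    · congr 1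
      · simp only [hX, Matrix.mulVec_sum, Matrix.mulVec_smul]
      · simp only [Finset.smul_sum, smul_smul]
        rw [Finset.sum_comm]
        simp only [← Finset.sum_smul]
        simp only [hX, Matrix.mulVec_sum, Matrix.mulVec_smul, Finset.smul_sum, smul_smul]
        refine Finset.sum_congr rfl fun j _ => ?_
        congr 1
        have h1 := congrFun (hud k) j
        have hsymm : (G * Gᵀ)ᵀ = G * Gᵀ := by
          rw [Matrix.transpose_mul, Matrix.transpose_transpose]
        rw [← hsymm, Matrix.mulVec_transpose] at h1
        exact h1
    · have h2 : (fun r => Wk k (0, r)) = ∑ e, v k e • (a e * a e) • z e := by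
        ext r
        simp [hWk, Finset.sum_apply, hw, mul_assoc]
      rw [h2]
      simp only [Finset.smul_sum]
      rw [Finset.sum_comm]
      refine Finset.sum_congr rfl fun e _ => ?_
      rw [smul_smul (Real.sqrt (d k)), ← hGv, Finset.sum_smul]
      refine Finset.sum_congr rfl fun i _ => ?_
      rw [smul_smul, mul_comm (u k i)]
  -- the family `u` is complete, so there is no residual
  have parseval : ∀ f : Fin N → Fin n → ℝ, ∑ i, toBilin' Y (f i) (f i) =
      ∑ k, toBilin' Y (∑ i, u k i • f i) (∑ i, u k i • f i) := by
    intro f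
    have h := sum_bilin_eq_sum_coeff_add_sum_residual (toBilin' Y) (toBilin'_comm hYs) u
      (fun k l hkl => by rw [hu1, if_neg hkl]) (fun k => Or.inl (by rw [hu1, if_pos rfl])) f
    rw [h, add_eq_left]
    refine Finset.sum_eq_zero fun i _ => ?_
    have : f i - ∑ k, u k i • ∑ i', u k i' • f i' = 0 := by
      rw [sub_eq_zero]
      simp only [Finset.smul_sum, smul_smul]
      rw [Finset.sum_comm]
      simp only [← Finset.sum_smul, hu2, ite_smul, one_smul, zero_smul]
      simp
    rw [this]
    simp
  have hlink := sum_bilin_eq_sum_coeff_add_sum_residual (linkForm Y P)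
    (linkForm_comm hYs hP.1) v hvo hvn fun e => multiplierVec (w e) (z e)
  have hWk' : ∀ k, ∑ e, v k e • w e = Wk k := fun k => rfl
  simp only [sum_smul_multiplierVec, multiplierVec_sub, hres, hWk'] at hlink
  simp only [hcoef] at hlink
  have hresid : ∀ e, linkForm Y P (multiplierVec (w e - ∑ k, v k e • Wk k) 0)
      (multiplierVec (w e - ∑ k, v k e • Wk k) 0) ≤ 0 := by
    intro e
    by_cases hex : ∃ k, d k ≠ 0
    · obtain ⟨k, hk⟩ := hex
      exact linkForm_nonpos_of_modalLMI hY (hmem k hk) _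
    · push Not at hex
      have hze : z e = 0 := by
        have := hres e
        simpa [hv0 _ (hex _)] using this
      have hwe : w e - ∑ k, v k e • Wk k = 0 := by
        have : w e = 0 := by
          ext c
          simp [hw, hze]
        simp [this, hWk0 _ (hex _)]
      rw [hwe, multiplierVec_zero]
      simp
  have hlow : 2 * ∑ e, toBilin' Y ((a e * b e) • z e) ((a e * b e) • z e) ≤
      ∑ e, linkForm Y P (multiplierVec (w e) (z e)) (multiplierVec (w e) (z e)) := by
    rw [Finset.mul_sum]
    refine Finset.sum_le_sum fun e _ => ?_
    rw [linkForm_multiplierVec, hw1]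
    have := multiplierSet_nonneg hP (hab e) (z e)
    linarith
  have hterm : ∀ k, (X k ≠ 0 → -toBilin' Y (X k) (X k)
      + toBilin' Y (∑ i, u k i • y i) (∑ i, u k i • y i)
      + linkForm Y P (multiplierVec (Wk k) (Real.sqrt (d k) • Ac *ᵥ X k))
        (multiplierVec (Wk k) (Real.sqrt (d k) • Ac *ᵥ X k)) < 0) ∧
      (-toBilin' Y (X k) (X k)
      + toBilin' Y (∑ i, u k i • y i) (∑ i, u k i • y i)
      + linkForm Y P (multiplierVec (Wk k) (Real.sqrt (d k) • Ac *ᵥ X k))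
        (multiplierVec (Wk k) (Real.sqrt (d k) • Ac *ᵥ X k)) ≤ 0) := by
    intro k
    rw [hYk]
    have hlt : X k ≠ 0 → -toBilin' Y (X k) (X k)
      + toBilin' Y (Ad *ᵥ X k + d k • Ap *ᵥ X k + Real.sqrt (d k) • fun r => Wk k (0, r))
        (Ad *ᵥ X k + d k • Ap *ᵥ X k + Real.sqrt (d k) • fun r => Wk k (0, r))
      + linkForm Y P (multiplierVec (Wk k) (Real.sqrt (d k) • Ac *ᵥ X k))
        (multiplierVec (Wk k) (Real.sqrt (d k) • Ac *ᵥ X k)) < 0 := by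
      intro hXk
      by_cases hk : d k = 0
      · have := hd.dotProduct_mulVec_pos hXk
        rw [hk, hWk0 k hk]
        simp only [Real.sqrt_zero, zero_smul, add_zero, multiplierVec_zero, map_zero,
          Matrix.toBilin'_apply']
        rw [star_trivial, Matrix.neg_mulVec, Matrix.sub_mulVec, dotProduct_neg, dotProduct_sub,
          ← Matrix.mulVec_mulVec, ← Matrix.mulVec_mulVec, Matrix.dotProduct_mulVec _ Adᵀ,
          Matrix.vecMul_transpose] at this
        linarith
      · rw [linkForm_multiplierVec]
        exact modalLMI_neg (hmem k hk) (X k) (Wk k) (Or.inl hXk)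
    refine ⟨hlt, ?_⟩
    by_cases hXk : X k = 0
    · by_cases hWz : Wk k = 0
      · have : (fun r => Wk k (0, r)) = 0 := by rw [hWz]; rfl
        rw [this, hXk, hWz]
        simp [multiplierVec_zero]
      · have hk : d k ≠ 0 := fun hk => hWz (hWk0 k hk)
        rw [linkForm_multiplierVec]
        exact (modalLMI_neg (hmem k hk) (X k) (Wk k) (Or.inr hWz)).le
    · exact (hlt hXk).le
  have hXne : ∃ k, X k ≠ 0 := by
    by_contra hcon
    push Not at hcon
    apply hx
    ext i : 1
    rw [hxX i]
    simp [hcon]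
  obtain ⟨k₀, hk₀⟩ := hXne
  have hsum : ∑ k, (-toBilin' Y (X k) (X k)
      + toBilin' Y (∑ i, u k i • y i) (∑ i, u k i • y i)
      + linkForm Y P (multiplierVec (Wk k) (Real.sqrt (d k) • Ac *ᵥ X k))
        (multiplierVec (Wk k) (Real.sqrt (d k) • Ac *ᵥ X k))) < ∑ k : Fin N, (0 : ℝ) :=
    Finset.sum_lt_sum (fun k _ => (hterm k).2) ⟨k₀, Finset.mem_univ _, (hterm k₀).1 hk₀⟩
  rw [Finset.sum_const_zero, Finset.sum_add_distrib, Finset.sum_add_distrib,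
    Finset.sum_neg_distrib, ← parseval y, ← parseval x] at hsum
  have hrs := Finset.sum_nonpos fun e (_ : e ∈ Finset.univ) => hresid e
  linarith

/-! ### Incidence matrix and Laplacian -/

/-- The incidence matrix of an undirected graph, one column per ordered pair of agents. Every
edge occurs in both directions, hence the normalisation `1 / √2`; pairs that are not edges have
zero columns. -/
noncomputable def incidence {N : ℕ} (E₀ : Finset (Fin N × Fin N)) :
    Matrix (Fin N) (Fin N × Fin N) ℝ :=
  Matrix.of fun l e => if e ∈ E₀ then
    (Real.sqrt 2)⁻¹ * ((if l = e.1 then 1 else 0) - (if l = e.2 then 1 else 0)) else 0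

theorem sum_incidence_smul_vertex {N : ℕ} {W : Type*} [AddCommGroup W] [Module ℝ W]
    (E₀ : Finset (Fin N × Fin N)) (x : Fin N → W) (e : Fin N × Fin N) :
    ∑ i, incidence E₀ i e • x i =
      if e ∈ E₀ then (Real.sqrt 2)⁻¹ • (x e.1 - x e.2) else 0 := by
  by_cases he : e ∈ E₀
  · simp [incidence, he, mul_smul, sub_smul, ← Finset.smul_sum, Finset.sum_sub_distrib]
  · simp [incidence, he]

/-- The incidence matrix applied to an antisymmetric edge signal: the two directions of an edge
contribute equally. -/
theorem sum_incidence_smul_edge {N : ℕ} {W : Type*} [AddCommGroup W] [Module ℝ W]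
    {E₀ : Finset (Fin N × Fin N)} (hE₀ : ∀ i j, (i, j) ∈ E₀ ↔ (j, i) ∈ E₀)
    (f : Fin N × Fin N → W) (hf : ∀ i j, (i, j) ∈ E₀ → f (j, i) = -f (i, j)) (l : Fin N) :
    ∑ e, incidence E₀ l e • f e =
      Real.sqrt 2 • ∑ j, if (l, j) ∈ E₀ then f (l, j) else 0 := by
  have h1 : ∑ e, incidence E₀ l e • f e = (Real.sqrt 2)⁻¹ •
      (∑ j, (if (l, j) ∈ E₀ then f (l, j) else 0)
        - ∑ i, (if (i, l) ∈ E₀ then f (i, l) else 0)) := by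
    rw [Fintype.sum_prod_type]
    have : ∀ i j, incidence E₀ l (i, j) • f (i, j) = (Real.sqrt 2)⁻¹ •
        ((if l = i then (if (i, j) ∈ E₀ then f (i, j) else 0) else 0)
          - (if l = j then (if (i, j) ∈ E₀ then f (i, j) else 0) else 0)) := by
      intro i j
      by_cases he : (i, j) ∈ E₀
      · simp [incidence, he, mul_smul, sub_smul]
      · simp [incidence, he]
    simp only [this, ← Finset.smul_sum, Finset.sum_sub_distrib]
    congr 2
    · rw [Finset.sum_comm]
      simp
    · simp
  have h2 : ∑ i, (if (i, l) ∈ E₀ then f (i, l) else 0) =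
      -∑ j, (if (l, j) ∈ E₀ then f (l, j) else 0) := by
    rw [← Finset.sum_neg_distrib]
    refine Finset.sum_congr rfl fun j _ => ?_
    by_cases he : (l, j) ∈ E₀
    · rw [if_pos he, if_pos ((hE₀ _ _).1 he), hf l j he]
    · rw [if_neg he, if_neg (fun h => he ((hE₀ _ _).1 h)), neg_zero]
  rw [h1, h2, sub_neg_eq_add, ← two_smul ℝ, smul_smul]
  congr 1
  have : Real.sqrt 2 ≠ 0 := by positivity
  field_simp
  norm_num

theorem sum_graphLaplacian_smul {N : ℕ} {W : Type*} [AddCommGroup W] [Module ℝ W]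
    (E : Finset (Fin N × Fin N)) (f : Fin N → W) (i : Fin N) :
    ∑ j, graphLaplacian E i j • f j = ∑ j, if (i, j) ∈ E then f i - f j else 0 := by
  classical
  rw [← Finset.add_sum_erase _ _ (Finset.mem_univ i),
    ← Finset.add_sum_erase (a := i) _ (fun j => if (i, j) ∈ E then f i - f j else 0)
      (Finset.mem_univ i)]
  have h1 : graphLaplacian E i i = ∑ j ∈ Finset.univ.erase i, if (i, j) ∈ E then (1 : ℝ) else 0 := by
    simp only [graphLaplacian, Matrix.of_apply, if_true, ← Finset.sum_neg_distrib]
    refine Finset.sum_congr (by ext; simp) fun j _ => ?_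
    split_ifs <;> simp
  rw [h1, Finset.sum_smul, ← Finset.sum_add_distrib]
  simp only [sub_self, ite_self, zero_add]
  refine Finset.sum_congr rfl fun j hj => ?_
  have hij : i ≠ j := (Finset.ne_of_mem_erase hj).symm
  simp only [graphLaplacian, Matrix.of_apply, if_neg hij]
  split_ifs <;> simp [sub_eq_add_neg]

theorem incidence_mul_transpose {N : ℕ} {E₀ : Finset (Fin N × Fin N)}
    (hE₀ : ∀ i j, (i, j) ∈ E₀ ↔ (j, i) ∈ E₀) :
    incidence E₀ * (incidence E₀)ᵀ = graphLaplacian E₀ := by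
  ext l m
  have h1 := sum_incidence_smul_edge hE₀ (fun e => incidence E₀ m e)
    (fun i j h => by simp [incidence, h, (hE₀ i j).1 h]; ring) l
  have h2 := sum_graphLaplacian_smul E₀ (fun j => (Pi.single m 1 : Fin N → ℝ) j) l
  rw [Matrix.mul_apply]
  simp only [Matrix.transpose_apply]
  simp only [smul_eq_mul] at h1 h2
  rw [h1]
  simp only [Pi.single_apply, mul_ite, mul_one, mul_zero, Finset.sum_ite_eq',
    Finset.mem_univ, if_true] at h2
  rw [h2, Finset.mul_sum]
  refine Finset.sum_congr rfl fun j _ => ?_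
  by_cases he : (l, j) ∈ E₀
  · have h2 : Real.sqrt 2 ≠ 0 := by positivity
    simp [incidence, he, eq_comm, mul_inv_cancel_left₀ h2]
  · simp [he]

/-! ### The averaged Lyapunov inequality -/

/-- Mean of a quadratic form of `c + ∑ θ j • z j` with uncorrelated Bernoulli variables `θ j`. -/
theorem mean_bilin_bernoulli_sum {K ι W : Type*} [Fintype K] [Fintype ι]
    [AddCommGroup W] [Module ℝ W] (B : LinearMap.BilinForm ℝ W) (hB : ∀ x y, B x y = B y x)
    (τ : K → ℝ) (hτ : ∑ a, τ a = 1) (θ : K → ι → ℝ) (π : ι → ℝ) (z : ι → W)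
    (h1 : ∀ j, z j ≠ 0 → ∑ a, τ a * θ a j = π j)
    (h2 : ∀ j, z j ≠ 0 → ∑ a, τ a * (θ a j * θ a j) = π j)
    (h3 : ∀ j k, j ≠ k → z j ≠ 0 → z k ≠ 0 → ∑ a, τ a * (θ a j * θ a k) = π j * π k) (c : W) :
    ∑ a, τ a * B (c + ∑ j, θ a j • z j) (c + ∑ j, θ a j • z j) =
      B (c + ∑ j, π j • z j) (c + ∑ j, π j • z j) + ∑ j, π j * (1 - π j) * B (z j) (z j) := by
  classical
  have hexp : ∀ t : ι → ℝ, B (c + ∑ j, t j • z j) (c + ∑ j, t j • z j) =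
      B c c + 2 * ∑ j, t j * B c (z j) + ∑ j, ∑ k, (t j * t k) * B (z j) (z k) := by
    intro t
    simp only [map_add, LinearMap.add_apply, map_sum, map_smul, LinearMap.sum_apply,
      LinearMap.smul_apply, smul_eq_mul, hB _ c]
    have : ∑ k, t k * ∑ j, t j * B (z j) (z k) = ∑ j, ∑ k, t j * t k * B (z j) (z k) := by
      simp only [Finset.mul_sum]
      rw [Finset.sum_comm]
      refine Finset.sum_congr rfl fun j _ => Finset.sum_congr rfl fun k _ => by ring
    rw [← this]
    simp only [mul_add, Finset.sum_add_distrib]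
    ring
  have e1 : ∑ a, τ a * ∑ j, θ a j * B c (z j) = ∑ j, π j * B c (z j) := by
    simp only [Finset.mul_sum]
    rw [Finset.sum_comm]
    refine Finset.sum_congr rfl fun j _ => ?_
    by_cases hj : z j = 0
    · simp [hj]
    · rw [← h1 j hj, Finset.sum_mul]
      exact Finset.sum_congr rfl fun a _ => by ring
  have e2 : ∑ a, τ a * ∑ j, ∑ k, (θ a j * θ a k) * B (z j) (z k) =
      ∑ j, ∑ k, (π j * π k) * B (z j) (z k) + ∑ j, π j * (1 - π j) * B (z j) (z j) := by
    simp only [Finset.mul_sum]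
    rw [Finset.sum_comm, ← Finset.sum_add_distrib]
    refine Finset.sum_congr rfl fun j _ => ?_
    rw [Finset.sum_comm]
    have : ∀ k, ∑ a, τ a * (θ a j * θ a k * B (z j) (z k)) =
        π j * π k * B (z j) (z k) + if j = k then π j * (1 - π j) * B (z j) (z j) else 0 := by
      intro k
      by_cases hj : z j = 0
      · simp [hj]
      by_cases hk : z k = 0
      · by_cases hjk : j = k
        · exact absurd (hjk ▸ hk) hj
        · simp [hk, hjk]
      have h0 : ∑ a, τ a * (θ a j * θ a k * B (z j) (z k)) =
          (∑ a, τ a * (θ a j * θ a k)) * B (z j) (z k) := by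
        rw [Finset.sum_mul]
        exact Finset.sum_congr rfl fun a _ => by ring
      rw [h0]
      by_cases hjk : j = k
      · subst hjk
        rw [h2 j hj, if_pos rfl]
        ring
      · rw [h3 j k hjk hj hk, if_neg hjk, add_zero]
    simp only [this, Finset.sum_add_distrib, Finset.sum_ite_eq, Finset.mem_univ, if_true]
  simp only [hexp, mul_add, Finset.sum_add_distrib]
  rw [← Finset.sum_mul, hτ, one_mul, e2]
  have : ∑ a, τ a * (2 * ∑ j, θ a j * B c (z j)) = 2 * ∑ a, τ a * ∑ j, θ a j * B c (z j) := by
    rw [Finset.mul_sum]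
    exact Finset.sum_congr rfl fun a _ => by ring
  rw [this, e1]
  ring

/-- The block-diagonal quadratic form `Xᵀ (I ⊗ Y) X`. -/
noncomputable def lyapunov {N n : ℕ} (Y : Matrix (Fin n) (Fin n) ℝ) (X : Fin N × Fin n → ℝ) : ℝ :=
  ∑ i, toBilin' Y (fun r => X (i, r)) fun r => X (i, r)

theorem decomposable_mulVec {N n : ℕ} (E E₀ : Finset (Fin N × Fin N))
    (Ad Ac Ap : Matrix (Fin n) (Fin n) ℝ) (X : Fin N × Fin n → ℝ) (i : Fin N) :
    (fun r => (((1 : Matrix (Fin N) (Fin N) ℝ) ⊗ₖ Ad + graphLaplacian E ⊗ₖ Ac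
      + graphLaplacian E₀ ⊗ₖ Ap) *ᵥ X) (i, r)) =
    (Ad *ᵥ fun r => X (i, r)) + ∑ j, graphLaplacian E₀ i j • (Ap *ᵥ fun r => X (j, r))
      + ∑ j, if (i, j) ∈ E then Ac *ᵥ ((fun r => X (i, r)) - fun r => X (j, r)) else 0 := by
  have hk : ∀ (L : Matrix (Fin N) (Fin N) ℝ) (A : Matrix (Fin n) (Fin n) ℝ),
      (fun r => ((L ⊗ₖ A) *ᵥ X) (i, r)) = ∑ j, L i j • (A *ᵥ fun r => X (j, r)) := by
    intro L A
    ext r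
    simp [Matrix.mulVec, dotProduct, Matrix.kroneckerMap_apply, Fintype.sum_prod_type,
      Finset.sum_apply, Finset.mul_sum, mul_assoc]
  have h1 := hk 1 Ad
  have h2 := hk (graphLaplacian E) Ac
  have h3 := hk (graphLaplacian E₀) Ap
  rw [sum_graphLaplacian_smul] at h2
  simp only [Matrix.one_apply, ite_smul, one_smul, zero_smul, Finset.sum_ite_eq,
    Finset.mem_univ, if_true] at h1
  simp only [Matrix.mulVec_sub]
  rw [← h1, ← h2, ← h3]
  ext r
  simp only [Matrix.add_mulVec, Pi.add_apply]
  ring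

/-- If under the weights `τ` the links are Bernoulli variables with admissible symmetric success
probabilities `π`, uncorrelated at each receiver, then the average of the block-diagonal Lyapunov
function over the modes decreases strictly. The two directions of a link may be correlated, as
they contribute to different rows of the Laplacian. -/
theorem mode_average_lyapunov_lt {N n : ℕ} {K : Type*} [Fintype K]
    {E₀ : Finset (Fin N × Fin N)} (hE₀ : ∀ i j, (i, j) ∈ E₀ ↔ (j, i) ∈ E₀)
    {E : K → Finset (Fin N × Fin N)} (hE : ∀ a, E a ⊆ E₀)
    {Ad Ac Ap Y : Matrix (Fin n) (Fin n) ℝ} {ρl ρu : ℝ}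
    (hρ0 : 0 ≤ ρl) (hρ : ρl ≤ ρu) (hρ1 : ρu ≤ 1)
    {P : Matrix ((Fin 3 × Fin n) ⊕ (Fin 2 × Fin n)) ((Fin 3 × Fin n) ⊕ (Fin 2 × Fin n)) ℝ}
    (hY : Y.PosDef) (hP : P ∈ multiplierSet ρl ρu n) (hd : (-(Adᵀ * Y * Ad - Y)).PosDef)
    (hLMI : ∀ lam ∈ nonzeroEigenvalues (graphLaplacian E₀), ModalLMI Ad Ac Ap Y P lam)
    (τ : K → ℝ) (hτ : ∑ a, τ a = 1) (π : Fin N → Fin N → ℝ)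
    (hπ : ∀ i j, (i, j) ∈ E₀ → π i j ∈ Set.Icc ρl ρu)
    (hπs : ∀ i j, (i, j) ∈ E₀ → π i j = π j i)
    (h1 : ∀ i j, (i, j) ∈ E₀ → ∑ a, τ a * (if (i, j) ∈ E a then (1 : ℝ) else 0) = π i j)
    (h2 : ∀ i j k, (i, j) ∈ E₀ → (i, k) ∈ E₀ → j ≠ k →
      ∑ a, τ a * ((if (i, j) ∈ E a then (1 : ℝ) else 0) * (if (i, k) ∈ E a then (1 : ℝ) else 0))
        = π i j * π i k)
    (X : Fin N × Fin n → ℝ) (hX : X ≠ 0) :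
    ∑ a, τ a * lyapunov Y (((1 : Matrix (Fin N) (Fin N) ℝ) ⊗ₖ Ad + graphLaplacian (E a) ⊗ₖ Ac
      + graphLaplacian E₀ ⊗ₖ Ap) *ᵥ X) < lyapunov Y X := by
  have hYs : Y.IsSymm := by simpa using hY.isHermitian
  set x : Fin N → Fin n → ℝ := fun i r => X (i, r) with hx
  have hx0 : x ≠ 0 := by
    intro h
    apply hX
    ext ⟨i, r⟩
    exact congrFun (congrFun h i) r
  set g : Fin N → Fin N → Fin n → ℝ :=
    fun i j => if (i, j) ∈ E₀ then Ac *ᵥ (x i - x j) else 0 with hg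
  have hg0 : ∀ i j, g i j ≠ 0 → (i, j) ∈ E₀ := by
    intro i j h
    by_contra hc
    exact h (by simp [hg, hc])
  -- outside of the nominal graph the success probability is immaterial but has to be admissible
  set π' : Fin N × Fin N → ℝ := fun e => if e ∈ E₀ then π e.1 e.2 else ρl with hπ'
  have hπ'm : ∀ e, π' e ∈ Set.Icc ρl ρu := by
    intro e
    by_cases he : e ∈ E₀
    · simpa [hπ', he] using hπ e.1 e.2 he
    · simpa [hπ', he] using hρ
  have hπ'0 : ∀ e, 0 ≤ π' e := fun e => hρ0.trans (hπ'm e).1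
  have hπ'1 : ∀ e, 0 ≤ 1 - π' e := fun e => sub_nonneg.2 ((hπ'm e).2.trans hρ1)
  set c : Fin N → Fin n → ℝ :=
    fun i => Ad *ᵥ x i + ∑ j, graphLaplacian E₀ i j • Ap *ᵥ x j with hc
  have hmean : ∑ a, τ a * lyapunov Y (((1 : Matrix (Fin N) (Fin N) ℝ) ⊗ₖ Ad
      + graphLaplacian (E a) ⊗ₖ Ac + graphLaplacian E₀ ⊗ₖ Ap) *ᵥ X) =
      ∑ i, (toBilin' Y (c i + ∑ j, π' (i, j) • g i j) (c i + ∑ j, π' (i, j) • g i j)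
        + ∑ j, π' (i, j) * (1 - π' (i, j)) * toBilin' Y (g i j) (g i j)) := by
    simp only [lyapunov, Finset.mul_sum]
    rw [Finset.sum_comm]
    refine Finset.sum_congr rfl fun i _ => ?_
    rw [← mean_bilin_bernoulli_sum (toBilin' Y) (toBilin'_comm hYs) τ hτ
      (fun a j => if (i, j) ∈ E a then (1 : ℝ) else 0) (fun j => π' (i, j)) (g i)
      (fun j hj => by simpa [hπ', hg0 i j hj] using h1 i j (hg0 i j hj))
      (fun j hj => by
        simpa only [hπ', hg0 i j hj, if_true, mul_ite, mul_one, mul_zero, ite_self, ← ite_and,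
          and_self] using h1 i j (hg0 i j hj))
      (fun j k hjk hj hk => by
        simpa only [hπ', hg0 i j hj, hg0 i k hk, if_true] using
          h2 i j k (hg0 i j hj) (hg0 i k hk) hjk) (c i)]
    refine Finset.sum_congr rfl fun a _ => ?_
    have : (fun r => (((1 : Matrix (Fin N) (Fin N) ℝ) ⊗ₖ Ad
        + graphLaplacian (E a) ⊗ₖ Ac + graphLaplacian E₀ ⊗ₖ Ap) *ᵥ X) (i, r)) =
        c i + ∑ j, (if (i, j) ∈ E a then (1 : ℝ) else 0) • g i j := by
      rw [decomposable_mulVec]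
      congr 1
      refine Finset.sum_congr rfl fun j _ => ?_
      by_cases he : (i, j) ∈ E a
      · simp [he, hg, hE a he, hx]
      · simp [he]
    rw [this]
  have hGx : ∀ e, Ac *ᵥ ∑ i, incidence E₀ i e • x i = (Real.sqrt 2)⁻¹ • g e.1 e.2 := by
    intro e
    rw [sum_incidence_smul_vertex]
    by_cases he : e ∈ E₀
    · simp [he, hg, Matrix.mulVec_smul]
    · simp [he, hg]
  have hsq : (Real.sqrt 2)⁻¹ * (Real.sqrt 2)⁻¹ = 1 / 2 := by
    rw [← mul_inv, Real.mul_self_sqrt (by norm_num)]; norm_num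
  have hgsymm : ∀ i j, g j i = -g i j := by
    intro i j
    by_cases he : (i, j) ∈ E₀
    · simp only [hg, he, (hE₀ i j).1 he, if_true, ← Matrix.mulVec_neg, neg_sub]
    · have he' : (j, i) ∉ E₀ := fun h => he ((hE₀ i j).2 h)
      simp [hg, he, he']
  have hdec := modal_decrease (incidence E₀) hY hP hd
    (by rwa [incidence_mul_transpose hE₀]) (fun e => Real.sqrt (π' e))
    (fun e => Real.sqrt (1 - π' e))
    (fun e => ⟨_, _, Real.sqrt_nonneg _, Real.sqrt_nonneg _,
      by rw [Real.sq_sqrt (hπ'0 e)]; exact hπ'm e,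
      by rw [Real.sq_sqrt (hπ'0 e), Real.sq_sqrt (hπ'1 e)], rfl⟩)
    x hx0 (fun e => (Real.sqrt 2)⁻¹ • g e.1 e.2) (fun e => (hGx e).symm)
    (fun i => c i + ∑ j, π' (i, j) • g i j) (by
      intro i
      rw [incidence_mul_transpose hE₀, sum_incidence_smul_edge hE₀, Finset.smul_sum]
      · refine congrArg (c i + ·) (Finset.sum_congr rfl fun j _ => ?_)
        by_cases he : (i, j) ∈ E₀
        · have h2 : Real.sqrt 2 ≠ 0 := by positivity
          rw [if_pos he, Real.mul_self_sqrt (hπ'0 _), smul_comm (π' (i, j)), smul_smul,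
            mul_inv_cancel₀ h2, one_smul]
        · simp [he, hg]
      · intro i j he
        simp only [Real.mul_self_sqrt (hπ'0 _), hgsymm i j, smul_neg]
        have : π' (j, i) = π' (i, j) := by
          simp [hπ', he, (hE₀ i j).1 he, hπs i j he]
        rw [this])
  rw [hmean, Finset.sum_add_distrib]
  refine lt_of_eq_of_lt (congrArg _ ?_) hdec
  rw [Fintype.sum_prod_type, Finset.mul_sum]
  refine Finset.sum_congr rfl fun i _ => ?_
  rw [Finset.mul_sum]
  refine Finset.sum_congr rfl fun j _ => ?_
  simp only [map_smul, LinearMap.smul_apply, smul_eq_mul]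
  have e1 := Real.mul_self_sqrt (hπ'0 (i, j))
  have e2 := Real.mul_self_sqrt (hπ'1 (i, j))
  calc π' (i, j) * (1 - π' (i, j)) * toBilin' Y (g i j) (g i j)
      = 2 * (1 / 2) * ((Real.sqrt (π' (i, j)) * Real.sqrt (π' (i, j)))
        * (Real.sqrt (1 - π' (i, j)) * Real.sqrt (1 - π' (i, j)))) *
        toBilin' Y (g i j) (g i j) := by rw [e1, e2]; ring
    _ = _ := by rw [← hsq]; ring

/-! ### Markov chains on a finite set of modes -/

theorem measurable_path {K Ω : Type*} [Finite K] [MeasurableSpace Ω] {σ : ℕ → Ω → K}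
    (hσ : ∀ k i, MeasurableSet {ω | σ k ω = i}) (n : ℕ) :
    @Measurable Ω (Fin (n + 1) → K) _ (@MeasurableSpace.pi _ _ fun _ => ⊤)
      fun ω l => σ l ω := by
  let _ : MeasurableSpace K := ⊤
  exact measurable_pi_lambda _ fun l => measurable_to_countable' fun i => hσ l i

theorem measurableSet_path {K Ω : Type*} [MeasurableSpace Ω] {σ : ℕ → Ω → K}
    (hσ : ∀ k i, MeasurableSet {ω | σ k ω = i}) (n : ℕ) (s : ℕ → K) :
    MeasurableSet {ω | ∀ k ≤ n, σ k ω = s k} := by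
  simp only [Set.ofPred_forall]
  exact MeasurableSet.iInter fun k => MeasurableSet.iInter fun _ => hσ k _

/-- A function of a finite part of the mode process takes finitely many values, hence is
integrable. -/
theorem integrable_of_path {K Ω : Type*} [Finite K] [MeasurableSpace Ω] {P : Measure Ω}
    [IsFiniteMeasure P] {σ : ℕ → Ω → K} (hσ : ∀ k i, MeasurableSet {ω | σ k ω = i}) (n : ℕ)
    (f : (ℕ → K) → ℝ) (hf : ∀ s s' : ℕ → K, (∀ k ≤ n, s k = s' k) → f s = f s') :
    Integrable (fun ω => f fun l => σ l ω) P := by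
  let _ : MeasurableSpace K := ⊤
  have hfin : Integrable (fun s : Fin (n + 1) → K => f fun l => s (Fin.ofNat (n + 1) l))
      (P.map fun ω l => σ l ω) := Integrable.of_finite
  have := hfin.comp_measurable (measurable_path hσ n)
  refine this.congr (Eventually.of_forall fun ω => hf _ _ fun k hk => ?_)
  simp [Nat.mod_eq_of_lt (Nat.lt_succ_of_le hk)]

/-- Conditioning on a finite part of the path: an integral is non-negative as soon as
all the conditional integrals are. -/
theorem integral_nonneg_of_cond_path {K Ω : Type*} [Finite K] [MeasurableSpace Ω] {P : Measure Ω}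
    [IsFiniteMeasure P] {σ : ℕ → Ω → K} (hσ : ∀ k i, MeasurableSet {ω | σ k ω = i}) (n : ℕ)
    {f : Ω → ℝ} (hf : Integrable f P)
    (h : ∀ s : ℕ → K, P {ω | ∀ k ≤ n, σ k ω = s k} ≠ 0 →
      0 ≤ ∫ ω, f ω ∂(P[|{ω | ∀ k ≤ n, σ k ω = s k}])) :
    0 ≤ ∫ ω, f ω ∂P := by
  classical
  have := Fintype.ofFinite K
  let ext : (Fin (n + 1) → K) → ℕ → K := fun s l => s (Fin.ofNat (n + 1) l)
  let ev : (Fin (n + 1) → K) → Set Ω := fun s => {ω | ∀ k ≤ n, σ k ω = ext s k}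
  have hev : ∀ s, MeasurableSet (ev s) := fun s => measurableSet_path hσ n _
  have hval : ∀ s ω, ω ∈ ev s → ∀ l : Fin (n + 1), σ l ω = s l := by
    intro s ω hω l
    have := hω l (Nat.le_of_lt_succ l.2)
    simpa [ext] using this
  have hcover : ⋃ s ∈ (Finset.univ : Finset (Fin (n + 1) → K)), ev s = Set.univ := by
    rw [Set.eq_univ_iff_forall]
    intro ω
    simp only [Set.mem_iUnion, Finset.mem_univ, exists_true_left]
    refine ⟨fun l => σ l ω, fun k hk => ?_⟩
    simp [ext, Nat.mod_eq_of_lt (Nat.lt_succ_of_le hk)]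
  have hdisj : (↑(Finset.univ : Finset (Fin (n + 1) → K)) : Set _).Pairwise
      (Function.onFun Disjoint ev) := by
    intro s _ s' _ hss
    refine Set.disjoint_left.2 fun ω h1 h2 => hss ?_
    ext l
    rw [← hval s ω h1 l, ← hval s' ω h2 l]
  rw [← setIntegral_univ, ← hcover, integral_biUnion_finset _ (fun s _ => hev s) hdisj
    fun s _ => hf.integrableOn]
  refine Finset.sum_nonneg fun s _ => ?_
  by_cases h0 : P (ev s) = 0
  · rw [Measure.restrict_eq_zero.2 h0, integral_zero_measure]
  · have h1 := h (ext s) h0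
    rw [ProbabilityTheory.cond, integral_smul_measure, smul_eq_mul] at h1
    have hpos : 0 < ((P (ev s))⁻¹).toReal :=
      ENNReal.toReal_pos (ENNReal.inv_ne_zero.2 (measure_ne_top _ _)) (ENNReal.inv_ne_top.2 h0)
    exact nonneg_of_mul_nonneg_right h1 hpos

/-- The Markov property: given a finite part of the path, the shifted process is a Markov chain
started from the last observed mode. -/
theorem IsMarkovChain.cond_shift {K Ω : Type*} [DecidableEq K] [MeasurableSpace Ω]
    {t : K → K → ℝ} {ν : K → ℝ} {P : Measure Ω} [IsFiniteMeasure P] {σ : ℕ → Ω → K}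
    (h : IsMarkovChain t ν P σ) (n : ℕ) (s : ℕ → K)
    (h0 : P {ω | ∀ k ≤ n, σ k ω = s k} ≠ 0) :
    IsMarkovChain t (Pi.single (s n) 1) (P[|{ω | ∀ k ≤ n, σ k ω = s k}])
      (fun l => σ (n + l)) := by
  refine ⟨fun k i => h.measurable _ _, fun m s' => ?_⟩
  set ev : Set Ω := {ω | ∀ k ≤ n, σ k ω = s k} with hev
  have hm : MeasurableSet ev := measurableSet_path h.measurable n s
  have hreal : P.real ev = ν (s 0) * ∏ k ∈ Finset.range n, t (s k) (s (k + 1)) := h.law n s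
  have hne : P.real ev ≠ 0 := by
    simpa [Measure.real, ENNReal.toReal_eq_zero_iff] using h0
  have hcond : ∀ S : Set Ω, (P[|ev]).real S = (P.real ev)⁻¹ * P.real (ev ∩ S) := by
    intro S
    simp [Measure.real, ProbabilityTheory.cond_apply hm, ENNReal.toReal_mul]
  rw [hcond]
  by_cases hs : s' 0 = s n
  · -- the two pieces fit together to one path of length `n + m`
    let c : ℕ → K := fun l => if l ≤ n then s l else s' (l - n)
    have hc1 : ∀ l ≤ n, c l = s l := fun l hl => if_pos hl
    have hc2 : ∀ l, c (n + l) = s' l := by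
      intro l
      rcases Nat.eq_zero_or_pos l with rfl | hl
      · simp [c, hs]
      · have : ¬ n + l ≤ n := by omega
        simp [c, Nat.ne_of_gt hl]
    have hset : ev ∩ {ω | ∀ k ≤ m, σ (n + k) ω = s' k} =
        {ω | ∀ k ≤ n + m, σ k ω = c k} := by
      ext ω
      constructor
      · rintro ⟨h1, h2⟩ k hk
        by_cases hkn : k ≤ n
        · rw [hc1 k hkn]; exact h1 k hkn
        · obtain ⟨l, rfl⟩ := Nat.exists_eq_add_of_le (Nat.le_of_not_le hkn)
          rw [hc2]; exact h2 l (by omega)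
      · intro h1
        refine ⟨fun k hk => ?_, fun k hk => ?_⟩
        · rw [← hc1 k hk]; exact h1 k (by omega)
        · rw [← hc2]; exact h1 _ (by omega)
    rw [hset, h.law (n + m) c, Finset.prod_range_add, hs, Pi.single_eq_same, one_mul]
    have e1 : ν (c 0) * ∏ k ∈ Finset.range n, t (c k) (c (k + 1)) = P.real ev := by
      rw [hreal, hc1 0 (Nat.zero_le n)]
      congr 1
      refine Finset.prod_congr rfl fun k hk => ?_
      have := Finset.mem_range.1 hk
      rw [hc1 k (by omega), hc1 (k + 1) (by omega)]
    have e2 : ∏ k ∈ Finset.range m, t (c (n + k)) (c (n + k + 1)) =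
        ∏ k ∈ Finset.range m, t (s' k) (s' (k + 1)) := by
      refine Finset.prod_congr rfl fun k _ => ?_
      rw [add_assoc, hc2, hc2]
    rw [← mul_assoc (ν (c 0)), e1, e2, inv_mul_cancel_left₀ hne]
  · have : ev ∩ {ω | ∀ k ≤ m, σ (n + k) ω = s' k} = ∅ := by
      ext ω
      simp only [Set.mem_inter_iff, Set.mem_ofPred_eq, Set.mem_empty_iff_false, iff_false, hev]
      rintro ⟨h1, h2⟩
      exact hs ((h2 0 (Nat.zero_le m)).symm.trans (h1 n le_rfl))
    rw [this, measureReal_empty, mul_zero, Pi.single_eq_of_ne hs, zero_mul]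

theorem IsMarkovChain.ae_initial {K Ω : Type*} [DecidableEq K] [MeasurableSpace Ω]
    {t : K → K → ℝ} {P : Measure Ω} [IsProbabilityMeasure P] {σ : ℕ → Ω → K} {b : K}
    (h : IsMarkovChain t (Pi.single b 1) P σ) : ∀ᵐ ω ∂P, σ 0 ω = b := by
  have h1 := h.law 0 fun _ => b
  have hset : {ω | ∀ k ≤ 0, σ k ω = b} = {ω | σ 0 ω = b} := by
    ext ω
    exact ⟨fun h => h 0 le_rfl, fun h k hk => by rw [Nat.le_zero.1 hk]; exact h⟩
  rw [hset] at h1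
  simp only [Pi.single_eq_same, Finset.range_zero, Finset.prod_empty, mul_one] at h1
  rw [ae_iff, ← Set.compl_ofPred, prob_compl_eq_zero_iff (h.measurable 0 b)]
  rw [Measure.real, ENNReal.toReal_eq_one_iff] at h1
  exact h1

theorem IsMarkovChain.real_next {K Ω : Type*} [DecidableEq K] [MeasurableSpace Ω]
    {t : K → K → ℝ} {P : Measure Ω} [IsProbabilityMeasure P] {σ : ℕ → Ω → K} {b : K}
    (h : IsMarkovChain t (Pi.single b 1) P σ) (a : K) : P.real {ω | σ 1 ω = a} = t b a := by
  have h1 := h.law 1 fun k => if k = 0 then b else a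
  simp only [if_true, Pi.single_eq_same, one_mul, Finset.range_one, Finset.prod_singleton,
    zero_add, one_ne_zero, if_false] at h1
  rw [← h1]
  refine measureReal_congr ?_
  filter_upwards [h.ae_initial] with ω hω
  apply propext
  change σ 1 ω = a ↔ ∀ k ≤ 1, σ k ω = if k = 0 then b else a
  constructor
  · intro h1 k hk
    interval_cases k
    · simpa using hω
    · simpa using h1
  · intro h1
    simpa using h1 1 le_rfl

theorem IsMarkovChain.integral_next {K Ω : Type*} [Fintype K] [DecidableEq K] [MeasurableSpace Ω]
    {t : K → K → ℝ} {P : Measure Ω} [IsProbabilityMeasure P] {σ : ℕ → Ω → K} {b : K}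
    (h : IsMarkovChain t (Pi.single b 1) P σ) (g : K → ℝ) :
    ∫ ω, g (σ 1 ω) ∂P = ∑ a, t b a * g a := by
  let _ : MeasurableSpace K := ⊤
  have hmeas : Measurable (σ 1) := measurable_to_countable' fun i => h.measurable 1 i
  have hmap : IsProbabilityMeasure (P.map (σ 1)) :=
    Measure.isProbabilityMeasure_map hmeas.aemeasurable
  rw [← integral_map (φ := σ 1) hmeas.aemeasurable (f := g)
    (Measurable.of_discrete).aestronglyMeasurable, integral_fintype Integrable.of_finite]
  refine Finset.sum_congr rfl fun a _ => ?_
  rw [map_measureReal_apply hmeas (MeasurableSet.singleton a), smul_eq_mul, ← h.real_next a]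
  rfl

theorem IsMarkovChain.real_next_mem {K Ω : Type*} [Fintype K] [DecidableEq K] [MeasurableSpace Ω]
    {t : K → K → ℝ} {P : Measure Ω} [IsProbabilityMeasure P] {σ : ℕ → Ω → K} {b : K}
    (h : IsMarkovChain t (Pi.single b 1) P σ) (p : K → Prop) [DecidablePred p] :
    P.real {ω | p (σ 1 ω)} = ∑ a, t b a * if p a then 1 else 0 := by
  rw [← h.integral_next fun a => if p a then 1 else 0]
  let _ : MeasurableSpace K := ⊤
  have hmeas : Measurable (σ 1) := measurable_to_countable' fun i => h.measurable 1 i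
  have hset : MeasurableSet {ω | p (σ 1 ω)} :=
    hmeas (MeasurableSet.of_discrete (s := {a | p a}))
  rw [← integral_indicator_one hset]
  refine integral_congr_ae (Eventually.of_forall fun ω => ?_)
  by_cases hp : p (σ 1 ω) <;> simp [hp]

/-! ### Packet loss given the previous mode -/

/-- The success probability of a link given that the previous mode is `b`. -/
def successProb {N : ℕ} {K : Type*} (E : K → Finset (Fin N × Fin N)) (p q : Fin N → Fin N → ℝ)
    (b : K) (i j : Fin N) : ℝ :=
  if (i, j) ∈ E b then p i j else q i j

/-- Since the initial mode is almost surely `b`, the conditioning on the state of a link at time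
zero is trivial and `p` or `q` is the unconditional success probability at time one. -/
theorem IsLossProcess.mean_next {N : ℕ} {K Ω : Type*} [Fintype K] [DecidableEq K]
    [MeasurableSpace Ω] {E₀ : Finset (Fin N × Fin N)} {E : K → Finset (Fin N × Fin N)}
    {t : K → K → ℝ} {p q : Fin N → Fin N → ℝ} {P : Measure Ω} [IsProbabilityMeasure P]
    {σ : ℕ → Ω → K} {b : K} (h : IsMarkovChain t (Pi.single b 1) P σ)
    (hl : IsLossProcess E₀ p q P fun k ω => E (σ k ω)) {i j : Fin N} (hij : (i, j) ∈ E₀) :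
    ∑ a, t b a * (if (i, j) ∈ E a then (1 : ℝ) else 0) = successProb E p q b i j := by
  have hae := h.ae_initial
  have hcond : ∀ S T : Set Ω, (∀ᵐ ω ∂P, ω ∈ S) → P S ≠ 0 ∧ (P[|S]).real T = P.real T := by
    intro S T hS
    have hSu : S =ᵐ[P] Set.univ := eventuallyEq_univ.2 hS
    have h1 : P S = 1 := by
      rw [measure_congr hSu, measure_univ]
    refine ⟨by rw [h1]; exact one_ne_zero, ?_⟩
    rw [ProbabilityTheory.cond, h1, inv_one, one_smul,
      Measure.restrict_congr_set hSu, Measure.restrict_univ]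
  rw [← h.real_next_mem fun a => (i, j) ∈ E a, successProb]
  by_cases hb : (i, j) ∈ E b
  · rw [if_pos hb]
    obtain ⟨h1, h2⟩ := hcond {ω | (i, j) ∈ E (σ 0 ω)} {ω | (i, j) ∈ E (σ 1 ω)}
      (hae.mono fun ω hω => by simpa [hω] using hb)
    rw [← h2]
    exact hl.success 0 i j hij h1
  · rw [if_neg hb]
    obtain ⟨h1, h2⟩ := hcond {ω | (i, j) ∉ E (σ 0 ω)} {ω | (i, j) ∈ E (σ 1 ω)}
      (hae.mono fun ω hω => by simpa [hω] using hb)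
    rw [← h2]
    exact hl.failure 0 i j hij h1

theorem IsLossProcess.mean_mul_next {N : ℕ} {K Ω : Type*} [Fintype K] [DecidableEq K]
    [MeasurableSpace Ω] {E₀ : Finset (Fin N × Fin N)} {E : K → Finset (Fin N × Fin N)}
    {t : K → K → ℝ} {p q : Fin N → Fin N → ℝ} {P : Measure Ω} [IsProbabilityMeasure P]
    {σ : ℕ → Ω → K} {b : K} (h : IsMarkovChain t (Pi.single b 1) P σ)
    (hl : IsLossProcess E₀ p q P fun k ω => E (σ k ω)) {i j k : Fin N} (hij : (i, j) ∈ E₀)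
    (hik : (i, k) ∈ E₀) (hjk : j ≠ k) :
    ∑ a, t b a * ((if (i, j) ∈ E a then (1 : ℝ) else 0) * (if (i, k) ∈ E a then (1 : ℝ) else 0))
      = successProb E p q b i j * successProb E p q b i k := by
  have hz : s(i, j) ≠ s(i, k) := by
    intro hc
    rcases Sym2.eq_iff.1 hc with ⟨_, h⟩ | ⟨h1, h2⟩
    · exact hjk h
    · exact hjk (h2.trans h1)
  have hind := (Indep_iff _ _ P).1 (hl.indep.indep hz)
    {ω | (i, j) ∈ E (σ 1 ω)} {ω | (i, k) ∈ E (σ 1 ω)}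
    (MeasurableSpace.measurableSet_generateFrom ⟨1, i, j, hij, rfl, rfl⟩)
    (MeasurableSpace.measurableSet_generateFrom ⟨1, i, k, hik, rfl, rfl⟩)
  rw [← hl.mean_next h hij, ← hl.mean_next h hik, ← h.real_next_mem fun a => (i, j) ∈ E a,
    ← h.real_next_mem fun a => (i, k) ∈ E a]
  have : ∀ a, (if (i, j) ∈ E a then (1 : ℝ) else 0) * (if (i, k) ∈ E a then (1 : ℝ) else 0) =
      if (i, j) ∈ E a ∧ (i, k) ∈ E a then 1 else 0 := by
    intro a
    by_cases h1 : (i, j) ∈ E a <;> by_cases h2 : (i, k) ∈ E a <;> simp [h1, h2]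
  simp only [this]
  rw [← h.real_next_mem fun a => (i, j) ∈ E a ∧ (i, k) ∈ E a]
  simp only [Measure.real, ← ENNReal.toReal_mul, ← hind]
  rfl

/-! ### Contraction and mean-square stability -/

/-- Comparison of two quadratic functions by compactness of the unit sphere; a strict pointwise
inequality yields a uniform factor below one. -/
theorem exists_le_mul_of_homogeneous {ι : Type*} [Fintype ι] (f g : (ι → ℝ) → ℝ)
    (hf : Continuous f) (hg : Continuous g) (hfh : ∀ (r : ℝ) x, f (r • x) = r ^ 2 * f x)
    (hgh : ∀ (r : ℝ) x, g (r • x) = r ^ 2 * g x) (hf0 : ∀ x, 0 ≤ f x)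
    (hg0 : ∀ x, x ≠ 0 → 0 < g x) :
    ∃ C : ℝ, 0 ≤ C ∧ (∀ x, f x ≤ C * g x) ∧ ((∀ x, x ≠ 0 → f x < g x) → C < 1) := by
  have hfz : f 0 = 0 := by simpa using hfh 0 0
  have hgz : g 0 = 0 := by simpa using hgh 0 0
  rcases (Metric.sphere (0 : ι → ℝ) 1).eq_empty_or_nonempty with he | hne
  · refine ⟨0, le_rfl, fun x => ?_, fun _ => one_pos⟩
    by_cases hx : x = 0
    · simp [hx, hfz]
    · exfalso
      have : ‖x‖⁻¹ • x ∈ Metric.sphere (0 : ι → ℝ) 1 := by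
        simp [norm_smul, inv_mul_cancel₀ (norm_ne_zero_iff.2 hx)]
      rw [he] at this
      exact this
  · have hs0 : ∀ u ∈ Metric.sphere (0 : ι → ℝ) 1, u ≠ 0 := by
      intro u hu h0
      simp [h0] at hu
    obtain ⟨u, hu, hmax⟩ := (isCompact_sphere (0 : ι → ℝ) 1).exists_isMaxOn hne
      (f := fun x => f x / g x)
      (hf.continuousOn.div hg.continuousOn fun x hx => (hg0 x (hs0 x hx)).ne')
    have hgu := hg0 u (hs0 u hu)
    refine ⟨f u / g u, div_nonneg (hf0 u) hgu.le, fun x => ?_,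
      fun h => (div_lt_one hgu).2 (h u (hs0 u hu))⟩
    by_cases hx : x = 0
    · simp [hx, hfz, hgz]
    · have hxn : ‖x‖ ≠ 0 := norm_ne_zero_iff.2 hx
      have hmem : ‖x‖⁻¹ • x ∈ Metric.sphere (0 : ι → ℝ) 1 := by
        simp [norm_smul, inv_mul_cancel₀ hxn]
      have h1 : f (‖x‖⁻¹ • x) / g (‖x‖⁻¹ • x) ≤ f u / g u := hmax hmem
      rw [hfh, hgh, mul_div_mul_left _ _ (by positivity)] at h1
      rwa [div_le_iff₀ (hg0 x hx)] at h1

theorem stateTrajectory_congr {K ι : Type*} [Fintype ι] (A : K → Matrix ι ι ℝ)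
    (x₀ : EuclideanSpace ℝ ι) {s s' : ℕ → K} {n : ℕ} (h : ∀ k < n, s k = s' k) :
    stateTrajectory A x₀ s n = stateTrajectory A x₀ s' n := by
  induction n with
  | zero => rfl
  | succ n ih =>
    rw [stateTrajectory, stateTrajectory, h n (Nat.lt_succ_self n),
      ih fun k hk => h k (hk.trans (Nat.lt_succ_self n))]

theorem norm_toEuclideanCLM_vecMulVec_le {ι : Type*} [Fintype ι] [DecidableEq ι]
    (x : EuclideanSpace ℝ ι) :
    ‖Matrix.toEuclideanCLM (n := ι) (𝕜 := ℝ) (Matrix.vecMulVec x.ofLp x.ofLp)‖ ≤ ‖x‖ ^ 2 := by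
  refine ContinuousLinearMap.opNorm_le_bound _ (by positivity) fun v => ?_
  have : Matrix.toEuclideanCLM (n := ι) (𝕜 := ℝ) (Matrix.vecMulVec x.ofLp x.ofLp) v =
      (inner ℝ x v : ℝ) • x := by
    ext i
    simp [Matrix.vecMulVec_mulVec, PiLp.inner_apply, dotProduct, mul_comm]
  rw [this, norm_smul]
  have h1 := norm_inner_le_norm (𝕜 := ℝ) x v
  nlinarith [norm_nonneg x]

theorem sq_integral_le_integral_sq {Ω : Type*} [MeasurableSpace Ω] {P : Measure Ω}
    [IsProbabilityMeasure P] {f : Ω → ℝ} (hf : Integrable f P)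
    (hf2 : Integrable (fun ω => f ω ^ 2) P) : (∫ ω, f ω ∂P) ^ 2 ≤ ∫ ω, f ω ^ 2 ∂P := by
  set m := ∫ ω, f ω ∂P with hm
  have h1 : 0 ≤ ∫ ω, (f ω ^ 2 - 2 * m * f ω + m ^ 2) ∂P :=
    integral_nonneg fun ω => by
      change 0 ≤ f ω ^ 2 - 2 * m * f ω + m ^ 2
      nlinarith [sq_nonneg (f ω - m)]
  have h2 : Integrable (fun ω => f ω ^ 2 - 2 * m * f ω) P := hf2.sub (hf.const_mul _)
  rw [integral_add h2 (integrable_const _), integral_sub hf2 (hf.const_mul _),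
    integral_const_mul, integral_const, ← hm] at h1
  simp at h1
  nlinarith

/-- A quadratic Lyapunov function that decreases on average, given any previous mode the chain can
be in, proves mean-square stability. -/
theorem MJLS.meanSquareStable_of_lyapunov {K ι : Type*} [Fintype K] [DecidableEq K] [Fintype ι]
    [DecidableEq ι] (M : MJLS K ι) (V : (ι → ℝ) → ℝ) (hVc : Continuous V)
    (hVh : ∀ (r : ℝ) x, V (r • x) = r ^ 2 * V x) (hV0 : ∀ x, x ≠ 0 → 0 < V x)
    (hdec : ∀ (b : K) (Ω : Type) (_ : MeasurableSpace Ω) (P : Measure Ω) (σ : ℕ → Ω → K),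
      IsProbabilityMeasure P → IsMarkovChain M.t (Pi.single b 1) P σ →
      ∀ x, x ≠ 0 → ∑ a, M.t b a * V (M.A a *ᵥ x) < V x) :
    M.MeanSquareStable := by
  classical
  have hVnn : ∀ x, 0 ≤ V x := by
    intro x
    by_cases hx : x = 0
    · have : V 0 = 0 := by simpa using hVh 0 0
      rw [hx, this]
    · exact (hV0 x hx).le
  intro x₀ ν Ω mΩ P σ hP hσ
  have hΩ : Nonempty Ω := nonempty_of_isProbabilityMeasure P
  have hK : Nonempty K := hΩ.map (σ 0)
  have hc : ∀ b, ∃ C : ℝ, 0 ≤ C ∧ (∀ x, ∑ a, M.t b a * V (M.A a *ᵥ x) ≤ C * V x) ∧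
      ((∀ x, x ≠ 0 → ∑ a, M.t b a * V (M.A a *ᵥ x) < V x) → C < 1) := by
    intro b
    refine exists_le_mul_of_homogeneous _ V ?_ hVc (fun r x => ?_) hVh
      (fun x => Finset.sum_nonneg fun a _ => mul_nonneg (M.t_nonneg b a) (hVnn _)) hV0
    · exact continuous_finsetSum _ fun a _ => continuous_const.mul
        (hVc.comp (continuous_const.matrix_mulVec continuous_id))
    · rw [Finset.mul_sum]
      refine Finset.sum_congr rfl fun a _ => ?_
      rw [Matrix.mulVec_smul, hVh]
      ring
  choose C hC0 hC1 hC2 using hc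
  -- modes the chain never visits carry no information and are given the rate `0`
  let D : K → ℝ := fun b => if C b < 1 then C b else 0
  obtain ⟨b₀, hb₀⟩ := Finite.exists_max D
  have hD0 : 0 ≤ D b₀ := by
    by_cases h : C b₀ < 1
    · simpa [D, h] using hC0 b₀
    · simp [D, h]
  have hD1 : D b₀ < 1 := by
    by_cases h : C b₀ < 1
    · simp [D, h]
    · simp [D, h]
  set c := D b₀
  let x : ℕ → Ω → EuclideanSpace ℝ ι := fun k ω => stateTrajectory M.A x₀ (fun l => σ l ω) k
  have hx_int : ∀ (k : ℕ) (g : EuclideanSpace ℝ ι → ℝ), Integrable (fun ω => g (x k ω)) P := by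
    intro k g
    exact integrable_of_path hσ.measurable k
      (fun s => g (stateTrajectory M.A x₀ s k)) fun s s' h =>
        congrArg g (stateTrajectory_congr M.A x₀ fun l hl => h l hl.le)
  have hstep : ∀ k, ∫ ω, V (x (k + 2) ω).ofLp ∂P ≤ c * ∫ ω, V (x (k + 1) ω).ofLp ∂P := by
    intro k
    rw [← sub_nonneg, ← integral_const_mul, ← integral_sub
      ((hx_int (k + 1) fun y => V y.ofLp).const_mul c) (hx_int (k + 2) fun y => V y.ofLp)]
    refine integral_nonneg_of_cond_path hσ.measurable k
      (((hx_int (k + 1) fun y => V y.ofLp).const_mul c).sub (hx_int (k + 2) fun y => V y.ofLp))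
      fun s hs => ?_
    set Q := P[|{ω | ∀ l ≤ k, σ l ω = s l}]
    have hQP : IsProbabilityMeasure Q := cond_isProbabilityMeasure hs
    have hch := hσ.cond_shift k s hs
    have hlt : C (s k) < 1 := hC2 _ (hdec (s k) Ω mΩ Q _ hQP hch)
    have hcs : C (s k) ≤ c := by
      have := hb₀ (s k)
      simpa [D, hlt] using this
    set y := stateTrajectory M.A x₀ s (k + 1)
    have hae : ∀ᵐ ω ∂Q, c * V (x (k + 1) ω).ofLp - V (x (k + 2) ω).ofLp =
        c * V y.ofLp - V (M.A (σ (k + 1) ω) *ᵥ y.ofLp) := by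
      filter_upwards [ae_cond_mem (measurableSet_path hσ.measurable k s)] with ω hω
      have h1 : x (k + 1) ω = y :=
        stateTrajectory_congr M.A x₀ fun l hl => hω l (Nat.le_of_lt_succ hl)
      have h2 : (x (k + 2) ω).ofLp = M.A (σ (k + 1) ω) *ᵥ (x (k + 1) ω).ofLp := rfl
      rw [h2, h1]
    rw [integral_congr_ae hae, hch.integral_next fun a => c * V y.ofLp - V (M.A a *ᵥ y.ofLp)]
    simp only [mul_sub, Finset.sum_sub_distrib, ← Finset.sum_mul, M.t_sum, one_mul]
    have h1 := hC1 (s k) y.ofLp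
    have h2 := mul_le_mul_of_nonneg_right hcs (hVnn y.ofLp)
    linarith
  have hgeo : ∀ k, ∫ ω, V (x (k + 1) ω).ofLp ∂P ≤ c ^ k * ∫ ω, V (x 1 ω).ofLp ∂P := by
    intro k
    induction k with
    | zero => simp
    | succ k ih =>
      refine (hstep k).trans ((mul_le_mul_of_nonneg_left ih hD0).trans_eq ?_)
      ring
  have hVlim : Tendsto (fun k => ∫ ω, V (x k ω).ofLp ∂P) atTop (𝓝 0) := by
    rw [← tendsto_add_atTop_iff_nat 1]
    refine squeeze_zero (fun k => integral_nonneg fun ω => hVnn _) hgeo ?_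
    simpa using (tendsto_pow_atTop_nhds_zero_of_lt_one hD0 hD1).mul_const _
  obtain ⟨B, -, hB, -⟩ := exists_le_mul_of_homogeneous
    (fun v : ι → ℝ => ‖(WithLp.toLp 2 v : EuclideanSpace ℝ ι)‖ ^ 2) V (by fun_prop) hVc
    (fun r v => by rw [WithLp.toLp_smul, norm_smul, mul_pow, Real.norm_eq_abs, sq_abs]) hVh
    (fun v => by positivity) hV0
  have hsq : Tendsto (fun k => ∫ ω, ‖x k ω‖ ^ 2 ∂P) atTop (𝓝 0) := by
    refine squeeze_zero (fun k => integral_nonneg fun ω => by positivity)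
      (g := fun k => B * ∫ ω, V (x k ω).ofLp ∂P) (fun k => ?_)
      (by simpa using hVlim.const_mul B)
    rw [← integral_const_mul]
    exact integral_mono (hx_int k fun y => ‖y‖ ^ 2) ((hx_int k fun y => V y.ofLp).const_mul B)
      fun ω => hB _
  constructor
  · have hle : ∀ k, ∫ ω, ‖x k ω‖ ∂P ≤ Real.sqrt (∫ ω, ‖x k ω‖ ^ 2 ∂P) := fun k =>
      Real.le_sqrt_of_sq_le (sq_integral_le_integral_sq (hx_int k fun y => ‖y‖)
        (hx_int k fun y => ‖y‖ ^ 2))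
    refine squeeze_zero (fun k => integral_nonneg fun ω => norm_nonneg _) hle ?_
    simpa using hsq.sqrt
  · refine squeeze_zero (fun k => integral_nonneg fun ω => norm_nonneg _) (fun k => ?_) hsq
    exact integral_mono (hx_int k fun y => ‖Matrix.toEuclideanCLM (n := ι) (𝕜 := ℝ)
      (Matrix.vecMulVec y.ofLp y.ofLp)‖) (hx_int k fun y => ‖y‖ ^ 2)
      fun ω => norm_toEuclideanCLM_vecMulVec_le _

/-! ### The block-diagonal Lyapunov function -/

theorem continuous_lyapunov {N n : ℕ} (Y : Matrix (Fin n) (Fin n) ℝ) :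
    Continuous (lyapunov (N := N) Y) := by
  unfold lyapunov
  simp only [Matrix.toBilin'_apply', dotProduct, Matrix.mulVec]
  fun_prop

theorem lyapunov_smul {N n : ℕ} (Y : Matrix (Fin n) (Fin n) ℝ) (r : ℝ) (X : Fin N × Fin n → ℝ) :
    lyapunov Y (r • X) = r ^ 2 * lyapunov Y X := by
  rw [lyapunov, lyapunov, Finset.mul_sum]
  refine Finset.sum_congr rfl fun i _ => ?_
  have : (fun k => (r • X) (i, k)) = r • fun k => X (i, k) := rfl
  simp only [this, map_smul, LinearMap.smul_apply, smul_eq_mul]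
  ring

theorem lyapunov_pos {N n : ℕ} {Y : Matrix (Fin n) (Fin n) ℝ} (hY : Y.PosDef)
    {X : Fin N × Fin n → ℝ} (hX : X ≠ 0) : 0 < lyapunov Y X := by
  obtain ⟨⟨i, k⟩, hik⟩ := Function.ne_iff.1 hX
  refine Finset.sum_pos' (fun i _ => toBilin'_self_nonneg hY _) ⟨i, Finset.mem_univ i, ?_⟩
  have hne : (fun k => X (i, k)) ≠ 0 := fun h => hik (congrFun h k)
  rw [Matrix.toBilin'_apply']
  simpa using hY.dotProduct_mulVec_pos hne

/-! ### Number of matrix inequalities -/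

/-- Constant vectors lie in the kernel of a Laplacian, so at most `N - 1` eigenvalues are
non-zero. -/
theorem encard_nonzeroEigenvalues_le {N : ℕ} (E : Finset (Fin N × Fin N)) :
    (nonzeroEigenvalues (graphLaplacian E)).encard ≤ ((N - 1 : ℕ) : ℕ∞) := by
  classical
  set f : Module.End ℝ (Fin N → ℝ) := Matrix.toLin' (graphLaplacian E) with hf
  have hcard : ∀ S : Finset ℝ, (∀ r ∈ S, f.HasEigenvalue r) → S.card ≤ N := by
    intro S hS
    have hli := Module.End.eigenvectors_linearIndependent f (↑S : Set ℝ)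
      (fun r => (hS r r.2).exists_hasEigenvector.choose)
      fun r => (hS r r.2).exists_hasEigenvector.choose_spec
    have := hli.fintype_card_le_finrank
    simpa using this
  have hfin : ∀ S : Finset ℝ, ↑S ⊆ nonzeroEigenvalues (graphLaplacian E) → S.card ≤ N - 1 := by
    intro S hS
    rcases Nat.eq_zero_or_pos N with hN | hN
    · subst hN
      exact (hcard S fun r hr => (hS hr).2)
    · have h0 : (0 : ℝ) ∉ S := fun h => (hS h).1 rfl
      have hz : f.HasEigenvalue 0 := by
        refine Module.End.hasEigenvalue_of_hasEigenvector (x := fun _ => 1) ⟨?_, ?_⟩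
        · rw [Module.End.mem_eigenspace_iff, hf, Matrix.toLin'_apply, zero_smul]
          ext i
          have := sum_graphLaplacian_smul E (fun _ => (1 : ℝ)) i
          simpa [Matrix.mulVec, dotProduct] using this
        · exact fun h => one_ne_zero (congrFun h ⟨0, hN⟩)
      have := hcard (insert 0 S) fun r hr => by
        rcases Finset.mem_insert.1 hr with rfl | hr
        · exact hz
        · exact (hS hr).2
      rw [Finset.card_insert_of_notMem h0] at this
      omega
  by_contra hcon
  push Not at hcon
  obtain ⟨T, hT, hTc⟩ := Set.exists_subset_encard_eq (Order.add_one_le_of_lt hcon)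
  have hTf : T.Finite := Set.finite_of_encard_eq_coe (k := N - 1 + 1) (by rw [hTc]; norm_cast)
  lift T to Finset ℝ using hTf
  rw [Set.encard_coe_eq_coe_finsetCard] at hTc
  have h1 := hfin T hT
  have h2 : T.card = N - 1 + 1 := by exact_mod_cast hTc
  omega

/-! ### Robust stability -/

theorem theorem3 {N n : ℕ} {K : Type*} [Fintype K] [DecidableEq K]
    (E₀ : Finset (Fin N × Fin N)) (hE₀ : ∀ i, (i, i) ∉ E₀)
    (E : K → Finset (Fin N × Fin N))
    (Ad Ac Ap : Matrix (Fin n) (Fin n) ℝ)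
    (M : MJLS K (Fin N × Fin n))
    (hM : ∀ a, M.A a = (1 : Matrix (Fin N) (Fin N) ℝ) ⊗ₖ Ad + graphLaplacian (E a) ⊗ₖ Ac
      + graphLaplacian E₀ ⊗ₖ Ap)
    (p q η : Fin N → Fin N → ℝ) (ρl ρu : ℝ)
    (hmarkov : IsMarkovPacketLoss E₀ E M.t M.μ p q η)
    (hsymm : IsSymmetricLoss E₀ E p q η)
    (hbound : IsBoundedLoss E₀ p q η ρl ρu) :
    ((∃ Y : Matrix (Fin n) (Fin n) ℝ, Y.PosDef ∧ ∃ P ∈ multiplierSet ρl ρu n,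
        (-(Adᵀ * Y * Ad - Y)).PosDef ∧
        ∀ lam ∈ nonzeroEigenvalues (graphLaplacian E₀), ModalLMI Ad Ac Ap Y P lam) →
      M.MeanSquareStable) ∧
    (nonzeroEigenvalues (graphLaplacian E₀)).encard ≤ ((N - 1 : ℕ) : ℕ∞) := by
  refine ⟨?_, encard_nonzeroEigenvalues_le E₀⟩
  rintro ⟨Y, hY, P, hP, hd, hLMI⟩
  refine M.meanSquareStable_of_lyapunov (lyapunov Y) (continuous_lyapunov Y) (lyapunov_smul Y)
    (fun X hX => lyapunov_pos hY hX) fun b Ω mΩ Q σ hQ hσ X hX => ?_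
  have hloss := hmarkov.process _ (Or.inr ⟨b, rfl⟩) Ω mΩ Q σ hQ hσ
  simp only [hM]
  refine mode_average_lyapunov_lt hsymm.undirected hmarkov.subset hbound.nonneg hbound.le
    hbound.le_one hY hP hd hLMI (M.t b) (M.t_sum b) (successProb E p q b) (fun i j hij => ?_)
    (fun i j hij => ?_) (fun i j hij => hloss.mean_next hσ hij)
    (fun i j k hij hik hjk => hloss.mean_mul_next hσ hij hik hjk) X hX
  · unfold successProb
    split_ifs
    · exact hbound.p_mem i j hij
    · exact hbound.q_mem i j hij
  -- the success probabilities are symmetric: either both directions of a link share their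
  -- previous state, or the previous state is irrelevant
  · have hp := hsymm.p_symm i j hij
    have hq := hsymm.q_symm i j hij
    unfold successProb
    rcases hsymm.symmetric_or_independent with h | h
    · by_cases hb : (i, j) ∈ E b
      · rw [if_pos hb, if_pos ((h b i j hij).1 hb), hp]
      · rw [if_neg hb, if_neg fun hc => hb ((h b i j hij).2 hc), hq]
    · rw [h i j hij, h j i ((hsymm.undirected i j).1 hij), ite_self, ite_self, hq]
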